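/- Let $X$ be a compact connected Riemann surface, $K$ its canonical bundle, $L$ a holomorphic line bundle on $X$ with $\deg L>0$, and let $\alpha\in H^0(X,L^2K)$ and $0\neq\beta\in H^0(X,L^{-2}K)$ satisfy $\mathrm{Div}(\alpha)\ge\mathrm{Div}(\beta)$, i.e. at every point the order of vanishing of $\alpha$ is at least that of $\beta$ (this holds by convention if $\alpha=0$). Let $\hbar\in\mathbb C^*$ and $R\ge 0$ satisfy $|\hbar^2R^2|\le 1$, and let $h_R$ be a smooth Hermitian metric on $L$ which solves the $R$-scaled vortex equation, i.e. in every local holomorphic coordinate $z$ and holomorphic frame of $L$, with $\alpha=\alpha(z)\,dz$, $\beta=\beta(z)\,dz$ and $h_R=h_R(z)>0$, $$\partial_{\bar z}\partial_z\log h_R=R^2\left(|\alpha(z)|^2h_R^2-|\beta(z)|^2h_R^{-2}\right).$$ Away from the zeros of $\beta$ put $$\mu=\hbar^2R^2\,\frac{\overline{\alpha}}{\beta}\,h_R^2 ,\qquad q=\left|\frac{\alpha h_R^2}{\beta}\right| .$$ Then the functions $|\mu|$ and $q$, which do not depend on the coordinate and the frame, extend to continuous functions on all of $X$, and for these extensions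 the following hold. 1. The function $u=\log q^2=\log\left|\alpha h_R^2/\beta\right|^2$ (with $u=-\infty$ where $q=0$) is smooth on $\{q\ne0\}$ and satisfies there, in every local holomorphic coordinate, the sinh-Gordon type equation $$\partial_{\bar z}\partial_z u=8R^2\,|\alpha(z)\beta(z)|\,\sinh(u/2).$$ 2. $u<0$ everywhere on $X$. 3. $|\mu|<1$ everywhere on $X$. -/

import Mathlib

open scoped Manifold ContDiff Laplacian ComplexConjugate Topology
open Bundle

noncomputable section

namespace HiggsSurface

variable {X : Type*} [TopologicalSpace X] [ChartedSpace ℂ X]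

/-- The coordinate vector field `∂/∂z` of the holomorphic chart `φ`, at the point of `X` with
coordinate `z`. -/
def coordVec (φ : OpenPartialHomeomorph X ℂ) (z : ℂ) : TangentSpace 𝓘(ℂ) (φ.symm z) :=
  mfderiv 𝓘(ℂ) 𝓘(ℂ) φ.symm z (1 : ℂ)

variable (L : X → Type*) [∀ x, AddCommGroup (L x)] [∀ x, Module ℂ (L x)]
  [∀ x, TopologicalSpace (L x)] [TopologicalSpace (TotalSpace ℂ L)] [FiberBundle ℂ L]
  [VectorBundle ℂ ℂ L]

variable {L} in
/-- The local frame of `L` given by a local trivialization `e`. -/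
def frame (e : Trivialization ℂ (π ℂ L)) (x : X) : L x := e.symm x 1

variable {L} in
/-- The dual local frame of `L⁻¹` given by a local trivialization `e`. -/
def coframe (e : Trivialization ℂ (π ℂ L)) [MemTrivializationAtlas e] (x : X) :
    Module.Dual ℂ (L x) := e.linearMapAt ℂ x

variable {L} in
/-- The coordinates `z` in the image of the chart `φ` at which the frame `e` is defined. -/
def coordDomain (φ : OpenPartialHomeomorph X ℂ) (e : Trivialization ℂ (π ℂ L)) : Set ℂ :=
  φ.target ∩ φ.symm ⁻¹' e.baseSet

/-- Holomorphic sections of `L² K = Hom(L⁻¹, L) ⊗ K`: at each point a complex-linear map from the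
tangent space to `Hom(L⁻¹, L)`, whose coefficients in holomorphic charts of the surface and
holomorphic frames of the bundle are holomorphic. -/
structure SecL2K where
  toFun : ∀ x : X, TangentSpace 𝓘(ℂ) x →ₗ[ℂ] Module.Dual ℂ (L x) →ₗ[ℂ] L x
  holo : ∀ φ ∈ atlas ℂ X, ∀ (e : Trivialization ℂ (π ℂ L)) [MemTrivializationAtlas e],
    DifferentiableOn ℂ
      (fun z => coframe e (φ.symm z) (toFun (φ.symm z) (coordVec φ z) (coframe e (φ.symm z))))
      (coordDomain φ e)

/-- Holomorphic sections of `L⁻² K = Hom(L, L⁻¹) ⊗ K`. -/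
structure SecLm2K where
  toFun : ∀ x : X, TangentSpace 𝓘(ℂ) x →ₗ[ℂ] L x →ₗ[ℂ] Module.Dual ℂ (L x)
  holo : ∀ φ ∈ atlas ℂ X, ∀ (e : Trivialization ℂ (π ℂ L)) [MemTrivializationAtlas e],
    DifferentiableOn ℂ
      (fun z => toFun (φ.symm z) (coordVec φ z) (frame e (φ.symm z)) (frame e (φ.symm z)))
      (coordDomain φ e)

/-- Smooth Hermitian metrics on the line bundle `L`. -/
structure HermMetric where
  form : ∀ x : X, L x →ₗ⋆[ℂ] L x →ₗ[ℂ] ℂ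
  conj_symm : ∀ x v w, conj (form x v w) = form x w v
  pos : ∀ x v, v ≠ 0 → 0 < (form x v v).re
  smooth : ∀ φ ∈ atlas ℂ X, ∀ (e : Trivialization ℂ (π ℂ L)) [MemTrivializationAtlas e],
    ContDiffOn ℝ ∞ (fun z => (form (φ.symm z) (frame e (φ.symm z)) (frame e (φ.symm z))).re)
      (coordDomain φ e)

variable {L}

/-- The coefficient `α(z)` of a section `α` of `L² K` in the chart `φ` and the frame `e`. -/
def SecL2K.coeff (α : SecL2K L) (φ : OpenPartialHomeomorph X ℂ) (e : Trivialization ℂ (π ℂ L))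
    [MemTrivializationAtlas e] (z : ℂ) : ℂ :=
  coframe e (φ.symm z) (α.toFun (φ.symm z) (coordVec φ z) (coframe e (φ.symm z)))

/-- The coefficient `β(z)` of a section `β` of `L⁻² K` in the chart `φ` and the frame `e`. -/
def SecLm2K.coeff (β : SecLm2K L) (φ : OpenPartialHomeomorph X ℂ) (e : Trivialization ℂ (π ℂ L))
    (z : ℂ) : ℂ :=
  β.toFun (φ.symm z) (coordVec φ z) (frame e (φ.symm z)) (frame e (φ.symm z))

/-- The positive function `h(z)` representing a metric in the chart `φ` and the frame `e`. -/
def HermMetric.coeff (h : HermMetric L) (φ : OpenPartialHomeomorph X ℂ)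
    (e : Trivialization ℂ (π ℂ L)) (z : ℂ) : ℝ :=
  (h.form (φ.symm z) (frame e (φ.symm z)) (frame e (φ.symm z))).re

/-- The divisor of zeros of `α`, as the function giving the order of vanishing at each point; it
is `⊤` everywhere if `α = 0`. -/
def SecL2K.div (α : SecL2K L) (x : X) : ℕ∞ :=
  analyticOrderAt (α.coeff (chartAt ℂ x) (trivializationAt ℂ L x)) (chartAt ℂ x x)

/-- The divisor of zeros of `β`, as the function giving the order of vanishing at each point. -/
def SecLm2K.div (β : SecLm2K L) (x : X) : ℕ∞ :=
  analyticOrderAt (β.coeff (chartAt ℂ x) (trivializationAt ℂ L x)) (chartAt ℂ x x)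

/-- The operator `∂_{z̄} ∂_z = Δ / 4` on real functions of a complex variable. -/
def dzbarDz (f : ℂ → ℝ) (z : ℂ) : ℝ := (1 / 4) * (Δ f) z

/-- The `R`-scaled vortex equation
`∂_{z̄} ∂_z log h = R² (|α|² h² - |β|² h⁻²)`, in all holomorphic charts and frames. -/
def SolvesVortex (R : ℝ) (α : SecL2K L) (β : SecLm2K L) (h : HermMetric L) : Prop :=
  ∀ φ ∈ atlas ℂ X, ∀ (e : Trivialization ℂ (π ℂ L)) [MemTrivializationAtlas e],
    ∀ z ∈ coordDomain φ e,
      dzbarDz (fun w => Real.log (h.coeff φ e w)) z =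
        R ^ 2 * (‖α.coeff φ e z‖ ^ 2 * h.coeff φ e z ^ 2
          - ‖β.coeff φ e z‖ ^ 2 * (h.coeff φ e z ^ 2)⁻¹)

/-- The coefficient of `dx ∧ dy` in the first Chern form `(i / 2π) ∂̄∂ log k` of the metric `k`, in
the chart `φ`. Since `dz̄ ∧ dz = 2i dx ∧ dy`, it is `-(1/π) ∂_{z̄} ∂_z log k`; the choice of the
holomorphic frame does not matter. -/
def chernDensity (k : HermMetric L) (φ : OpenPartialHomeomorph X ℂ) (z : ℂ) : ℝ :=
  -(1 / Real.pi) *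
    dzbarDz (fun w => Real.log (k.coeff φ (trivializationAt ℂ L (φ.symm z)) w)) z

variable (X) in
/-- A finite continuous partition of unity on `X` subordinate to holomorphic charts. -/
structure ChartPartition where
  n : ℕ
  chart : Fin n → OpenPartialHomeomorph X ℂ
  chart_mem : ∀ i, chart i ∈ atlas ℂ X
  weight : Fin n → C(X, ℝ)
  weight_nonneg : ∀ i x, 0 ≤ weight i x
  tsupport_subset : ∀ i, tsupport (weight i) ⊆ (chart i).source
  sum_eq_one : ∀ x, ∑ i, weight i x = 1

/-- The integral over `X` of the 2-form with coefficient `f φ` (with respect to `dx ∧ dy`) in each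
chart `φ`, computed with a partition of unity. -/
def ChartPartition.integral (P : ChartPartition X)
    (f : OpenPartialHomeomorph X ℂ → ℂ → ℝ) : ℝ :=
  ∑ i, ∫ z in (P.chart i).target, P.weight i ((P.chart i).symm z) * f (P.chart i) z

variable (L) in
/-- `HasDegree L d`: the degree `∫_X c₁(L)` of `L` is `d`. The integral of the Chern form does not
depend on the metric or on the partition of unity by which it is computed. -/
def HasDegree (d : ℤ) : Prop :=
  ∃ (k : HermMetric L) (P : ChartPartition X), P.integral (chernDensity k) = d

/-- The coefficient `μ(z) = ħ² R² (conj α(z) / β(z)) h(z)²` of `μ`, for `β(z) ≠ 0`. -/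
def muCoeff (ħ : ℂ) (R : ℝ) (α : SecL2K L) (β : SecLm2K L) (h : HermMetric L)
    (φ : OpenPartialHomeomorph X ℂ) (e : Trivialization ℂ (π ℂ L)) [MemTrivializationAtlas e]
    (z : ℂ) : ℂ :=
  ħ ^ 2 * (R : ℂ) ^ 2 * (conj (α.coeff φ e z) / β.coeff φ e z) * (h.coeff φ e z : ℂ) ^ 2

end HiggsSurface

end

/-!
Write `q = |α h² / β|`. Because `Div α ≥ Div β`, the quotient `α / β` is locally given by a
holomorphic function `G` (in a chart and a frame), so `q = |G| h²` extends continuously over the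
zeros of `β`. Where `q ≠ 0`, `log |G|` is harmonic, so `∂_{z̄} ∂_z log q² = 4 ∂_{z̄} ∂_z log h`, and
the vortex equation turns the right-hand side into `4 R² |β|² h⁻² (q² - 1)`, which is the
sinh-Gordon equation (`quotient_chart_properties`, `vortex_rhs_eq`).

The bound `q < 1` is a strong maximum principle. If the maximum `M` of `q` is at least `1`, then
`v = log M² - log q²` is nonnegative with zeros and satisfies `Δv ≤ C v` locally, since
`1 - M² e⁻ᵛ ≤ v`. By comparison with the barrier `ρ² / |z - y|² - 1`, such a function vanishes near
each of its zeros (`eq_zero_on_ball_of_laplacian_le`). Hence `{q = M}` is open and closed, `q` is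
constant, and `∂_{z̄} ∂_z log h = 4⁻¹ ∂_{z̄} ∂_z log q² = 0`: the metric `h` is flat. This is
impossible because `deg L ≠ 0`: with `h` flat, the Chern form of any metric `k` is a multiple of
`Δ log (k / h) dx ∧ dy`, where `log (k / h)` is a function on `X`, and `∫_X Δf = 0`
(`HasDegree.eq_zero_of_flat`, `ChartPartition.integral_laplacian_eq_zero`). The case of a maximum
exactly `1` and the case `R = 0` need no separate treatment. Finally `|μ| = |ħ² R²| q ≤ q < 1`.
-/

noncomputable section

namespace HiggsSurface

/-! ### The Laplacian on the complex plane -/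

lemma laplacian_eq_fderiv_fderiv (f : ℂ → ℝ) (z : ℂ) :
    (Δ f) z = fderiv ℝ (fderiv ℝ f) z 1 1 + fderiv ℝ (fderiv ℝ f) z Complex.I Complex.I := by
  rw [InnerProductSpace.laplacian_eq_iteratedFDeriv_complexPlane]
  simp [iteratedFDeriv_two_apply]

/-- The Laplacian is conformally covariant: composing with a holomorphic map `τ` multiplies it by
`‖τ'‖²`. The first order terms cancel, since `τ''` is contracted with `1² + i² = 0`. -/
lemma laplacian_comp_holomorphic {F : ℂ → ℝ} {τ : ℂ → ℂ} {z : ℂ}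
    (hF : ContDiffAt ℝ 2 F (τ z)) (hτ : AnalyticAt ℂ τ z) :
    (Δ (fun w => F (τ w))) z = ‖deriv τ z‖ ^ 2 * (Δ F) (τ z) := by
  have hτ' : AnalyticAt ℂ (deriv τ) z := hτ.deriv
  have h1 : ∀ᶠ w in 𝓝 z, ∀ v : ℂ,
      fderiv ℝ (fun w => F (τ w)) w v = fderiv ℝ F (τ w) (deriv τ w * v) := by
    have hF1 : ∀ᶠ w in 𝓝 (τ z), ContDiffAt ℝ 2 F w := hF.eventually (by simp)
    filter_upwards [hτ.continuousAt.eventually hF1, hτ.eventually_analyticAt] with w hw hw2 v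
    have a := (hw.differentiableAt (by norm_num)).hasFDerivAt
    have b := (hw2.differentiableAt.hasDerivAt).complexToReal_fderiv
    have c : HasFDerivAt (fun w => F (τ w)) _ w := a.comp w b
    rw [c.fderiv]
    simp
  have hDF : DifferentiableAt ℝ (fderiv ℝ F) (τ z) :=
    (hF.fderiv_right (m := 1) (by norm_num)).differentiableAt (by norm_num)
  have h2 : ∀ v : ℂ, fderiv ℝ (fderiv ℝ (fun w => F (τ w))) z v v =
      fderiv ℝ (fderiv ℝ F) (τ z) (deriv τ z * v) (deriv τ z * v) +
        fderiv ℝ F (τ z) (deriv (deriv τ) z * v * v) := by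
    intro v
    have hd : DifferentiableAt ℝ (fderiv ℝ (fun w => F (τ w))) z := by
      have : ContDiffAt ℝ 2 (fun w => F (τ w)) z :=
        hF.comp z (hτ.contDiffAt.restrict_scalars ℝ)
      exact (this.fderiv_right (m := 1) (by norm_num)).differentiableAt (by norm_num)
    have e1 : fderiv ℝ (fderiv ℝ (fun w => F (τ w))) z v v =
        fderiv ℝ (fun w => fderiv ℝ (fun w => F (τ w)) w v) z v := by
      rw [fderiv_clm_apply hd (differentiableAt_const v)]
      simp
    have e2 : (fun w => fderiv ℝ (fun w => F (τ w)) w v) =ᶠ[𝓝 z]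
        fun w => fderiv ℝ F (τ w) (deriv τ w * v) := h1.mono fun w hw => hw v
    have a := (hτ.differentiableAt.hasDerivAt).complexToReal_fderiv
    have b := (hτ'.differentiableAt.hasDerivAt.mul_const v).complexToReal_fderiv
    have c := (hDF.hasFDerivAt.comp z a).clm_apply b
    rw [e1, e2.fderiv_eq]
    erw [c.fderiv]
    simp [add_comm]
  have key : ∀ B : ℂ →L[ℝ] ℂ →L[ℝ] ℝ, ∀ t : ℂ,
      B (t * 1) (t * 1) + B (t * Complex.I) (t * Complex.I) =
        ‖t‖ ^ 2 * (B 1 1 + B Complex.I Complex.I) := by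
    intro B t
    have ht1 : t * 1 = t.re • (1 : ℂ) + t.im • Complex.I := by
      apply Complex.ext <;> simp
    have ht2 : t * Complex.I = t.re • Complex.I - t.im • (1 : ℂ) := by
      apply Complex.ext <;> simp
    rw [ht1, ht2, ← Complex.normSq_eq_norm_sq, Complex.normSq_apply]
    simp only [map_add, map_sub, map_smul, add_apply,
      sub_apply, smul_apply, smul_eq_mul]
    ring
  rw [laplacian_eq_fderiv_fderiv, h2, h2, laplacian_eq_fderiv_fderiv, ← key]
  have : deriv (deriv τ) z * Complex.I * Complex.I = -(deriv (deriv τ) z * 1 * 1) := by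
    rw [mul_assoc, Complex.I_mul_I]; ring
  rw [this, map_neg]
  ring

lemma laplacian_norm_sq (z : ℂ) : (Δ (fun w : ℂ => ‖w‖ ^ 2)) z = 4 := by
  have h1 : fderiv ℝ (fun w : ℂ => ‖w‖ ^ 2) = fun w => (2 : ℝ) • innerSL ℝ w := by
    ext1 w
    rw [(hasStrictFDerivAt_norm_sq w).hasFDerivAt.fderiv]
    norm_num [two_smul]
  have h2 : fderiv ℝ (fun w : ℂ => (2 : ℝ) • (innerSL ℝ w : ℂ →L[ℝ] ℝ)) z =
      (2 : ℝ) • innerSL ℝ :=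
    ((innerSL ℝ : ℂ →L[ℝ] ℂ →L[ℝ] ℝ).hasFDerivAt.const_smul (2 : ℝ)).fderiv
  rw [laplacian_eq_fderiv_fderiv, h1, h2]
  have h3 : ∀ v : ℂ, innerSL ℝ v v = ‖v‖ ^ 2 := fun v => by simp
  change 2 * innerSL ℝ (1 : ℂ) (1 : ℂ) + 2 * innerSL ℝ Complex.I Complex.I = (4 : ℝ)
  rw [h3, h3]
  norm_num

lemma laplacian_nonneg_of_isLocalMin {w : ℂ → ℝ} {p : ℂ} (hw : ContDiffAt ℝ 2 w p)
    (hp : IsLocalMin w p) : 0 ≤ (Δ w) p := by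
  have key : ∀ v : ℂ, 0 ≤ fderiv ℝ (fderiv ℝ w) p v v := by
    intro v
    set g : ℝ → ℝ := fun t => w (p + t • v) with hg
    have hl : ∀ t : ℝ, HasDerivAt (fun t : ℝ => p + t • v) v t := fun t => by
      simpa using ((hasDerivAt_id t).smul_const v).const_add p
    have hl0 : Filter.Tendsto (fun t : ℝ => p + t • v) (𝓝 0) (𝓝 p) := by
      have := (hl 0).continuousAt.tendsto
      simpa using this
    have hg1 : deriv g =ᶠ[𝓝 0] fun t => fderiv ℝ w (p + t • v) v := by
      filter_upwards [hl0.eventually (hw.eventually (by simp))] with t ht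
      exact ((ht.differentiableAt (by norm_num)).hasFDerivAt.comp_hasDerivAt t (hl t)).deriv
    have hDw : DifferentiableAt ℝ (fderiv ℝ w) p :=
      (hw.fderiv_right (m := 1) (by norm_num)).differentiableAt (by norm_num)
    have hg2 : deriv (deriv g) 0 = fderiv ℝ (fderiv ℝ w) p v v := by
      rw [hg1.deriv_eq]
      have h0 : HasFDerivAt (fun z => fderiv ℝ w z v) ((fderiv ℝ (fderiv ℝ w) p).flip v)
          (p + (0 : ℝ) • v) := by
        have := hDw.hasFDerivAt.clm_apply (hasFDerivAt_const v p)
        simpa using this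
      exact (h0.comp_hasDerivAt (0 : ℝ) (hl 0)).deriv
    have hmin : IsLocalMin g 0 := by
      have : ∀ᶠ t in 𝓝 (0 : ℝ), w p ≤ w (p + t • v) := hl0.eventually hp
      simpa [IsLocalMin, IsMinFilter, hg] using this
    have hgc : ContinuousAt g 0 := by
      have : ContinuousAt w (p + (0 : ℝ) • v) := by simpa using hw.continuousAt
      exact this.comp (f := fun t : ℝ => p + t • v) (hl 0).continuousAt
    rw [← hg2]
    by_contra! hneg
    -- a strict second derivative test makes `0` a local maximum too, so `g` is locally constant
    have hmax := isLocalMax_of_deriv_deriv_neg hneg hmin.deriv_eq_zero hgc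
    have hcst : g =ᶠ[𝓝 0] fun _ => g 0 := by
      filter_upwards [hmin, hmax] with t h1 h2 using le_antisymm h2 h1
    have := hcst.deriv.deriv_eq
    simp at this
    linarith
  rw [laplacian_eq_fderiv_fderiv]
  exact add_nonneg (key _) (key _)

/-- The barrier `‖z - y‖⁻²` used in the strong minimum principle. -/
lemma laplacian_norm_sub_inv_sq {y z : ℂ} (hz : z ≠ y) :
    ContDiffAt ℝ 2 (fun w : ℂ => ‖(w - y)⁻¹‖ ^ 2) z ∧
      (Δ (fun w : ℂ => ‖(w - y)⁻¹‖ ^ 2)) z = 4 * (‖(z - y)⁻¹‖ ^ 2) ^ 2 := by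
  have hz' : z - y ≠ 0 := sub_ne_zero.2 hz
  have ha : AnalyticAt ℂ (fun w : ℂ => (w - y)⁻¹) z :=
    (analyticAt_id.sub analyticAt_const).inv hz'
  have hF : ContDiffAt ℝ 2 (fun w : ℂ => ‖w‖ ^ 2) ((z - y)⁻¹) :=
    (contDiff_norm_sq ℝ).contDiffAt
  refine ⟨hF.comp z (ha.contDiffAt.restrict_scalars ℝ), ?_⟩
  have hd : deriv (fun w : ℂ => (w - y)⁻¹) z = -1 / (z - y) ^ 2 :=
    (((hasDerivAt_id z).sub_const y).inv hz').deriv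
  have := laplacian_comp_holomorphic (F := fun w => ‖w‖ ^ 2) (τ := fun w => (w - y)⁻¹) hF ha
  rw [this, laplacian_norm_sq, hd]
  simp
  ring

/-- The strong minimum principle for supersolutions of `Δ - C`, in local form. If `v` were positive
at `y` near its zero `x₀`, then `v ≥ ε (ρ² / ‖z - y‖² - 1)` on an annulus around `y` that contains
`x₀`, by comparison on the boundary of the annulus. -/
lemma eq_zero_on_ball_of_laplacian_le {v : ℂ → ℝ} {x₀ : ℂ} {C ρ : ℝ} (hρ : 0 < ρ)
    (hCρ : C * ρ ^ 2 < 4)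
    (hv : ∀ z ∈ Metric.ball x₀ (2 * ρ), ContDiffAt ℝ 2 v z ∧ 0 ≤ v z ∧ (Δ v) z ≤ C * v z)
    (hC : 0 ≤ C) (h0 : v x₀ = 0) : ∀ y ∈ Metric.ball x₀ ρ, v y = 0 := by
  intro y hy
  by_contra hne
  have hy2 : y ∈ Metric.ball x₀ (2 * ρ) := Metric.ball_subset_ball (by linarith) hy
  have hvy : 0 < v y := lt_of_le_of_ne (hv y hy2).2.1 (Ne.symm hne)
  have hxy : dist x₀ y < ρ := by rw [dist_comm]; exact hy
  have hxy0 : 0 < dist x₀ y := by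
    rw [dist_pos]; rintro rfl; exact hne h0
  -- `v ≥ δ` on a small closed ball of radius `s` around `y`
  obtain ⟨s, hs0, hsx, hs⟩ : ∃ s > 0, s < dist x₀ y ∧ ∀ z, dist z y ≤ s → v y / 2 ≤ v z := by
    have : ∀ᶠ z in 𝓝 y, v y / 2 < v z :=
      (hv y hy2).1.continuousAt.eventually (lt_mem_nhds (by linarith))
    obtain ⟨t, ht, h⟩ := Metric.eventually_nhds_iff.1 this
    refine ⟨min (t / 2) (dist x₀ y / 2), by positivity, ?_, fun z hz => (h ?_).le⟩
    · exact (min_le_right _ _).trans_lt (by linarith)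
    · exact (hz.trans (min_le_left _ _)).trans_lt (by linarith)
  set b : ℂ → ℝ := fun w => ‖(w - y)⁻¹‖ ^ 2 with hb
  have hbd : ∀ z, b z = (dist z y ^ 2)⁻¹ := fun z => by
    simp [hb, dist_eq_norm]
  set ε : ℝ := v y / 2 * s ^ 2 / ρ ^ 2 with hε
  have hεpos : 0 < ε := by positivity
  -- the comparison function `v - ε (ρ² b - 1)`
  set w : ℂ → ℝ := fun z => v z - (ε * ρ ^ 2) * b z + ε with hw
  set K : Set ℂ := Metric.closedBall y ρ \ Metric.ball y s with hK
  have hKcomp : IsCompact K := (isCompact_closedBall y ρ).diff Metric.isOpen_ball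
  have hKsub : ∀ z ∈ K, z ∈ Metric.ball x₀ (2 * ρ) ∧ z ≠ y := by
    rintro z ⟨h1, h2⟩
    refine ⟨?_, ?_⟩
    · rw [Metric.mem_ball]
      rw [Metric.mem_closedBall] at h1
      have := dist_triangle z y x₀
      rw [dist_comm y x₀] at this
      linarith
    · rintro rfl
      exact h2 (Metric.mem_ball_self hs0)
  have hwC : ∀ z ∈ K, ContDiffAt ℝ 2 w z := by
    intro z hz
    obtain ⟨h1, h2⟩ := hKsub z hz
    exact ((hv z h1).1.sub (contDiffAt_const.mul (laplacian_norm_sub_inv_sq h2).1)).add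
      contDiffAt_const
  have hx₀K : x₀ ∈ K := ⟨Metric.mem_closedBall.2 hxy.le, by
    rw [Metric.mem_ball, not_lt]; exact hsx.le⟩
  obtain ⟨p, hpK, hpmin⟩ := hKcomp.exists_isMinOn ⟨x₀, hx₀K⟩
    (fun z hz => (hwC z hz).continuousAt.continuousWithinAt)
  have hwx₀ : w x₀ < 0 := by
    have h2 : 1 < ρ ^ 2 * b x₀ := by
      rw [hbd, ← div_eq_mul_inv, one_lt_div (by positivity)]
      exact pow_lt_pow_left₀ hxy hxy0.le (by norm_num)
    have : w x₀ = ε * (1 - ρ ^ 2 * b x₀) := by simp only [hw, h0]; ring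
    rw [this]
    exact mul_neg_of_pos_of_neg hεpos (by linarith)
  have hwp : w p < 0 := (hpmin hx₀K).trans_lt hwx₀
  obtain ⟨hp1, hp2⟩ := hKsub p hpK
  obtain ⟨hvC, hvp, hΔv⟩ := hv p hp1
  have hps : s < dist p y := by
    by_contra! hle
    have heq : dist p y = s := le_antisymm hle (by
      have := hpK.2; rwa [Metric.mem_ball, not_lt] at this)
    have h3 := hs p hle
    have : ε * ρ ^ 2 * b p = v y / 2 := by
      rw [hbd, heq, hε]; field_simp
    simp only [hw] at hwp
    linarith
  have hpρ : dist p y < ρ := by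
    by_contra! hle
    have heq : dist p y = ρ := le_antisymm (Metric.mem_closedBall.1 hpK.1) hle
    have : ε * ρ ^ 2 * b p = ε := by
      rw [hbd, heq]; field_simp
    simp only [hw] at hwp
    linarith
  have hloc : IsLocalMin w p := by
    refine hpmin.isLocalMin ?_
    have h1 : {z | s < dist z y} ∈ 𝓝 p :=
      (isOpen_lt continuous_const (by fun_prop)).mem_nhds hps
    have h2 : {z | dist z y < ρ} ∈ 𝓝 p :=
      (isOpen_lt (by fun_prop) continuous_const).mem_nhds hpρ
    filter_upwards [h1, h2] with z hz1 hz2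
    exact ⟨Metric.mem_closedBall.2 (le_of_lt hz2), by
      rw [Metric.mem_ball, not_lt]; exact le_of_lt hz1⟩
  have hΔ := laplacian_nonneg_of_isLocalMin (hwC p hpK) hloc
  obtain ⟨hbC, hbΔ⟩ := laplacian_norm_sub_inv_sq hp2
  have hΔw : (Δ w) p = (Δ v) p - ε * ρ ^ 2 * (4 * b p ^ 2) := by
    have e : w = (v - (ε * ρ ^ 2) • b) + fun _ => ε := by
      ext z; simp [hw]
    have hb' : ContDiffAt ℝ 2 ((ε * ρ ^ 2) • b) p := contDiffAt_const.smul hbC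
    have hvb : ContDiffAt ℝ 2 (v - (ε * ρ ^ 2) • b) p := hvC.sub hb'
    rw [e, hvb.laplacian_add contDiffAt_const, hvC.laplacian_sub hb',
      InnerProductSpace.laplacian_smul _ hbC, hbΔ]
    simp [hb]
  have hbp : 1 ≤ ρ ^ 2 * b p := by
    rw [hbd, ← div_eq_mul_inv, one_le_div (by have := hs0.trans hps; positivity)]
    exact pow_le_pow_left₀ dist_nonneg hpρ.le 2
  -- `Δ w < C w < 0` at the minimum
  have hbpos : 0 < b p := by
    by_contra! hle
    nlinarith [sq_nonneg ρ]
  have h5 : C * v p ≤ C * (ε * ρ ^ 2 * b p) := by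
    apply mul_le_mul_of_nonneg_left _ hC
    simp only [hw] at hwp
    linarith
  have h6 : C * (ε * ρ ^ 2 * b p) < ε * ρ ^ 2 * (4 * b p ^ 2) := by
    have : C < 4 * b p := by
      by_contra! hle
      nlinarith [sq_nonneg ρ]
    have h7 : 0 < ε * ρ ^ 2 * b p := by positivity
    nlinarith
  linarith

/-- The integral over the plane of the Laplacian of a compactly supported function vanishes. -/
lemma integral_laplacian_eq_zero {F : ℂ → ℝ} (hF : ContDiff ℝ 2 F) (hc : HasCompactSupport F) :
    ∫ z, (Δ F) z = 0 := by
  have hD : ContDiff ℝ 1 (fderiv ℝ F) := hF.fderiv_right (by norm_num)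
  have hcD : HasCompactSupport (fderiv ℝ F) := hc.fderiv ℝ
  have hDD : Continuous (fderiv ℝ (fderiv ℝ F)) := hD.continuous_fderiv (by norm_num)
  have hcDD : HasCompactSupport (fderiv ℝ (fderiv ℝ F)) := hcD.fderiv ℝ
  have hint : ∀ v : ℂ, MeasureTheory.Integrable (fun z => fderiv ℝ (fderiv ℝ F) z v v) := by
    intro v
    refine Continuous.integrable_of_hasCompactSupport (by fun_prop) ?_
    refine hcDD.comp_left (g := fun B : ℂ →L[ℝ] ℂ →L[ℝ] ℝ => B v v) (by simp)
  have key : ∀ v : ℂ, ∫ z, fderiv ℝ (fderiv ℝ F) z v v = 0 := by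
    intro v
    have hG : ∀ z,
        HasLineDerivAt ℝ (fun z => fderiv ℝ F z v) (fderiv ℝ (fderiv ℝ F) z v v) z v := by
      intro z
      have h1 := (hD.differentiable (by norm_num) z).hasFDerivAt.clm_apply (hasFDerivAt_const v z)
      have := h1.hasLineDerivAt v
      simpa using this
    have h1 : ∀ z, HasLineDerivAt ℝ (fun _ : ℂ => (1 : ℝ)) 0 z v := fun z => by
      simpa using (hasFDerivAt_const (1 : ℝ) z).hasLineDerivAt v
    have hGint : MeasureTheory.Integrable (fun z => fderiv ℝ F z v) :=
      Continuous.integrable_of_hasCompactSupport (by fun_prop)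
        (hcD.comp_left (g := fun B : ℂ →L[ℝ] ℝ => B v) (by simp))
    have := integral_bilinear_hasLineDerivAt_right_eq_neg_left_of_integrable
      (μ := MeasureTheory.volume) (B := ContinuousLinearMap.mul ℝ ℝ)
      (f := fun _ : ℂ => (1 : ℝ)) (f' := fun _ => 0) (v := v)
      (g := fun z => fderiv ℝ F z v) (g' := fun z => fderiv ℝ (fderiv ℝ F) z v v)
      (by simp) (by simpa using hint v) (by simpa using hGint) (fun z _ => h1 z)
      (fun z _ => hG z)
    simpa using this
  simp_rw [laplacian_eq_fderiv_fderiv]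
  rw [MeasureTheory.integral_add (hint _) (hint _), key, key, add_zero]

/-! ### Smooth functions and the Laplacian on a Riemann surface -/

section Surface

variable {X : Type*} [TopologicalSpace X]

/-- The Laplacian in a chart vanishes where the function vanishes identically. -/
lemma laplacian_chart_eq_zero {f : X → ℝ} {φ : OpenPartialHomeomorph X ℂ} {z : ℂ}
    (hz : z ∈ φ.target) (hzf : φ.symm z ∉ tsupport f) : (Δ (f ∘ φ.symm)) z = 0 := by
  have h1 : ∀ᶠ w in 𝓝 z, φ.symm w ∈ (tsupport f)ᶜ :=
    (φ.continuousAt_symm hz).eventually ((isClosed_tsupport f).isOpen_compl.mem_nhds hzf)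
  have h2 : f ∘ φ.symm =ᶠ[𝓝 z] fun _ => 0 := h1.mono fun w hw =>
    image_eq_zero_of_notMem_tsupport (f := f) hw
  rw [(InnerProductSpace.laplacian_congr_nhds h2).eq_of_nhds]
  simp

lemma integrableOn_chart_target [CompactSpace X] {φ : OpenPartialHomeomorph X ℂ} {g : ℂ → ℝ}
    (hg : ContinuousOn g φ.target) {T : Set X} (hT : IsClosed T) (hTφ : T ⊆ φ.source)
    (h0 : ∀ z ∈ φ.target, φ.symm z ∉ T → g z = 0) :
    MeasureTheory.IntegrableOn g φ.target := by
  have hK : IsCompact (φ '' T) := hT.isCompact.image_of_continuousOn (φ.continuousOn.mono hTφ)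
  have hKt : φ '' T ⊆ φ.target := by
    rintro _ ⟨x, hx, rfl⟩
    exact φ.map_source (hTφ hx)
  refine ((hg.mono hKt).integrableOn_compact hK).of_forall_sdiff_eq_zero
    φ.open_target.measurableSet fun z hz => h0 z hz.1 fun hzT => hz.2 ?_
  exact ⟨_, hzT, φ.right_inv hz.1⟩

variable [ChartedSpace ℂ X]

/-- Smoothness of a real function on a Riemann surface, tested in the holomorphic charts of the
atlas. -/
def ChartSmooth (f : X → ℝ) : Prop :=
  ∀ φ ∈ atlas ℂ X, ContDiffOn ℝ ∞ (f ∘ φ.symm) φ.target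

lemma ChartSmooth.contDiffAt {f : X → ℝ} (hf : ChartSmooth f) {φ : OpenPartialHomeomorph X ℂ}
    (hφ : φ ∈ atlas ℂ X) {z : ℂ} (hz : z ∈ φ.target) {n : ℕ} : ContDiffAt ℝ n (f ∘ φ.symm) z :=
  ((hf φ hφ).contDiffAt (φ.open_target.mem_nhds hz)).of_le (by exact_mod_cast le_top)

lemma continuousOn_laplacian {F : ℂ → ℝ} {s : Set ℂ} (hs : IsOpen s)
    (hF : ContDiffOn ℝ ∞ F s) : ContinuousOn (Δ F) s := by
  intro z hz
  have h1 : ∀ n : ℕ, ContDiffAt ℝ n F z := fun n =>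
    (hF.contDiffAt (hs.mem_nhds hz)).of_le (by exact_mod_cast le_top)
  have h2 : ContDiffAt ℝ 0 (fderiv ℝ (fderiv ℝ F)) z :=
    ((h1 2).fderiv_right (m := 1)
      (by norm_num)).fderiv_right (m := 0) (by norm_num)
  have h3 : ContinuousAt (fderiv ℝ (fderiv ℝ F)) z := h2.continuousAt
  have h4 : Δ F = fun z => fderiv ℝ (fderiv ℝ F) z 1 1 +
      fderiv ℝ (fderiv ℝ F) z Complex.I Complex.I := funext fun z => laplacian_eq_fderiv_fderiv F z
  rw [h4]
  exact ContinuousAt.continuousWithinAt (by fun_prop)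

lemma laplacian_finset_sum {ι : Type*} (s : Finset ι) {F : ι → ℂ → ℝ} {z : ℂ}
    (hF : ∀ i ∈ s, ContDiffAt ℝ 2 (F i) z) :
    (Δ (fun w => ∑ i ∈ s, F i w)) z = ∑ i ∈ s, (Δ (F i)) z := by
  classical
  induction s using Finset.induction_on with
  | empty => simp [laplacian_eq_fderiv_fderiv]
  | insert a s ha ih =>
    have e : (fun w => ∑ i ∈ insert a s, F i w) = F a + fun w => ∑ i ∈ s, F i w := by
      ext w; simp [Finset.sum_insert ha]
    have h2 : ContDiffAt ℝ 2 (fun w => ∑ i ∈ s, F i w) z :=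
      ContDiffAt.sum fun i hi => hF i (Finset.mem_insert_of_mem hi)
    rw [e, (hF a (Finset.mem_insert_self a s)).laplacian_add h2,
      ih fun i hi => hF i (Finset.mem_insert_of_mem hi), Finset.sum_insert ha]

lemma analyticAt_transition [IsManifold 𝓘(ℂ) ω X] {φ ψ : OpenPartialHomeomorph X ℂ}
    (hφ : φ ∈ atlas ℂ X) (hψ : ψ ∈ atlas ℂ X) {z : ℂ} (hz : z ∈ ψ.target)
    (hzφ : ψ.symm z ∈ φ.source) : AnalyticAt ℂ (φ ∘ ψ.symm) z := by
  have h := (contDiffGroupoid ω 𝓘(ℂ)).compatible hψ hφ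
  rw [contDiffGroupoid, mem_groupoid_of_pregroupoid] at h
  have h1 : ContDiffOn ℂ ω (φ ∘ ψ.symm) (ψ.symm ≫ₕ φ).source := by
    simpa [contDiffPregroupoid] using h.1
  have hz' : z ∈ (ψ.symm ≫ₕ φ).source := by
    simp [hz, hzφ]
  exact (h1.contDiffAt ((ψ.symm ≫ₕ φ).open_source.mem_nhds hz')).analyticAt

lemma isManifold_real [IsManifold 𝓘(ℂ) ω X] : IsManifold 𝓘(ℝ, ℂ) ∞ X := by
  refine isManifold_of_contDiffOn 𝓘(ℝ, ℂ) ∞ X fun ψ φ hψ hφ => ?_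
  intro z hz
  have hz' : z ∈ ψ.target ∧ ψ.symm z ∈ φ.source := by simpa using hz
  have := (analyticAt_transition hφ hψ hz'.1 hz'.2).contDiffAt (n := ∞)
  exact (this.restrict_scalars ℝ).contDiffWithinAt

lemma ChartSmooth.of_contMDiff [IsManifold 𝓘(ℝ, ℂ) ∞ X] {f : X → ℝ}
    (hf : ContMDiff 𝓘(ℝ, ℂ) 𝓘(ℝ) ∞ f) : ChartSmooth f := by
  intro φ hφ
  have h1 : ContMDiffOn 𝓘(ℝ, ℂ) 𝓘(ℝ, ℂ) ∞ φ.symm φ.target :=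
    contMDiffOn_symm_of_mem_maximalAtlas (IsManifold.subset_maximalAtlas hφ)
  exact (hf.comp_contMDiffOn h1).contDiffOn

lemma ChartSmooth.mul {f g : X → ℝ} (hf : ChartSmooth f) (hg : ChartSmooth g) :
    ChartSmooth (fun x => f x * g x) := fun φ hφ => (hf φ hφ).mul (hg φ hφ)

lemma det_restrictScalars_smul_one (c : ℂ) :
    (c • (1 : ℂ →L[ℝ] ℂ)).det = ‖c‖ ^ 2 := by
  rw [← Complex.normSq_eq_norm_sq, ← Algebra.norm_complex_apply, Algebra.norm_apply,
    ContinuousLinearMap.det]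
  congr 1

/-- The 2-form `w Δf dx ∧ dy` has the same integral in the charts `φ` and `ψ`, if its support lies
in both. -/
lemma setIntegral_laplacian_chart_change [IsManifold 𝓘(ℂ) ω X] {φ ψ : OpenPartialHomeomorph X ℂ}
    (hφ : φ ∈ atlas ℂ X) (hψ : ψ ∈ atlas ℂ X) {f w : X → ℝ} (hf : ChartSmooth f)
    (hw : tsupport w ⊆ φ.source) (hfψ : tsupport f ⊆ ψ.source) :
    ∫ z in φ.target, w (φ.symm z) * (Δ (f ∘ φ.symm)) z =
      ∫ z in ψ.target, w (ψ.symm z) * (Δ (f ∘ ψ.symm)) z := by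
  set τ : ℂ → ℂ := φ ∘ ψ.symm with hτ
  set S : Set ℂ := (φ.symm ≫ₕ ψ).source with hS
  set S' : Set ℂ := (ψ.symm ≫ₕ φ).source with hS'
  have hSm : ∀ z, z ∈ S ↔ z ∈ φ.target ∧ φ.symm z ∈ ψ.source := fun z => by simp [hS]
  have hS'm : ∀ z, z ∈ S' ↔ z ∈ ψ.target ∧ ψ.symm z ∈ φ.source := fun z => by simp [hS']
  have e1 : ∫ z in φ.target, w (φ.symm z) * (Δ (f ∘ φ.symm)) z =
      ∫ z in S, w (φ.symm z) * (Δ (f ∘ φ.symm)) z := by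
    refine MeasureTheory.setIntegral_eq_of_subset_of_forall_sdiff_eq_zero
      φ.open_target.measurableSet (fun z hz => ((hSm z).1 hz).1) fun z hz => ?_
    rw [laplacian_chart_eq_zero hz.1 (fun h => hz.2 ((hSm z).2 ⟨hz.1, hfψ h⟩)), mul_zero]
  have e2 : ∫ z in ψ.target, w (ψ.symm z) * (Δ (f ∘ ψ.symm)) z =
      ∫ z in S', w (ψ.symm z) * (Δ (f ∘ ψ.symm)) z := by
    refine MeasureTheory.setIntegral_eq_of_subset_of_forall_sdiff_eq_zero
      ψ.open_target.measurableSet (fun z hz => ((hS'm z).1 hz).1) fun z hz => ?_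
    have : w (ψ.symm z) = 0 :=
      image_eq_zero_of_notMem_tsupport fun h => hz.2 ((hS'm z).2 ⟨hz.1, hw h⟩)
    rw [this, zero_mul]
  have himg : τ '' S' = S := by
    ext z
    constructor
    · rintro ⟨y, hy, rfl⟩
      obtain ⟨h1, h2⟩ := (hS'm y).1 hy
      refine (hSm _).2 ⟨φ.map_source h2, ?_⟩
      simpa [hτ, φ.left_inv h2] using ψ.map_target h1
    · intro hz
      obtain ⟨h1, h2⟩ := (hSm z).1 hz
      refine ⟨ψ (φ.symm z), (hS'm _).2 ⟨ψ.map_source h2, ?_⟩, ?_⟩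
      · simpa [ψ.left_inv h2] using φ.map_target h1
      · simp [hτ, ψ.left_inv h2, φ.right_inv h1]
  have hinj : Set.InjOn τ S' := (ψ.symm ≫ₕ φ).injOn
  have han : ∀ z ∈ S', AnalyticAt ℂ τ z := fun z hz =>
    analyticAt_transition hφ hψ ((hS'm z).1 hz).1 ((hS'm z).1 hz).2
  rw [e1, e2, ← himg, MeasureTheory.integral_image_eq_integral_abs_det_fderiv_smul
    MeasureTheory.volume (ψ.symm ≫ₕ φ).open_source.measurableSet
    (fun z hz => ((han z hz).differentiableAt.hasDerivAt.complexToReal_fderiv).hasFDerivWithinAt)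
    hinj]
  refine MeasureTheory.setIntegral_congr_fun (ψ.symm ≫ₕ φ).open_source.measurableSet
    fun z hz => ?_
  obtain ⟨h1, h2⟩ := (hS'm z).1 hz
  have h3 : f ∘ ψ.symm =ᶠ[𝓝 z] fun y => (f ∘ φ.symm) (τ y) := by
    filter_upwards [(ψ.symm ≫ₕ φ).open_source.mem_nhds hz] with y hy
    simp [hτ, φ.left_inv ((hS'm y).1 hy).2]
  have h4 : τ z ∈ φ.target := φ.map_source h2
  have h5 := laplacian_comp_holomorphic (hf.contDiffAt hφ h4 (n := 2)) (han z hz)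
  have h6 : φ.symm (τ z) = ψ.symm z := φ.left_inv h2
  simp only [smul_eq_mul]
  rw [(InnerProductSpace.laplacian_congr_nhds h3).eq_of_nhds, h5, det_restrictScalars_smul_one,
    h6, abs_of_nonneg (by positivity)]
  ring

/-- Stokes' theorem `∫_X Δf = 0` for a function supported in a single chart. -/
lemma setIntegral_laplacian_chart_eq_zero [T2Space X] [CompactSpace X]
    {ψ : OpenPartialHomeomorph X ℂ}
    (hψ : ψ ∈ atlas ℂ X) {f : X → ℝ} (hf : ChartSmooth f) (hfψ : tsupport f ⊆ ψ.source) :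
    ∫ z in ψ.target, (Δ (f ∘ ψ.symm)) z = 0 := by
  classical
  set F : ℂ → ℝ := ψ.target.indicator (f ∘ ψ.symm) with hF
  set K : Set ℂ := ψ '' tsupport f with hK
  have hKc : IsCompact K :=
    (isClosed_tsupport f).isCompact.image_of_continuousOn (ψ.continuousOn.mono hfψ)
  have hF0 : ∀ z ∉ K, F z = 0 := by
    intro z hz
    by_cases hzt : z ∈ ψ.target
    · rw [hF, Set.indicator_of_mem hzt]
      exact image_eq_zero_of_notMem_tsupport (f := f) fun h => hz ⟨_, h, ψ.right_inv hzt⟩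
    · exact Set.indicator_of_notMem hzt _
  have hFt : ∀ z ∈ ψ.target, F =ᶠ[𝓝 z] f ∘ ψ.symm := fun z hz => by
    filter_upwards [ψ.open_target.mem_nhds hz] with y hy
    exact Set.indicator_of_mem hy _
  have hFn : ∀ z ∉ K, F =ᶠ[𝓝 z] fun _ => 0 := fun z hz => by
    filter_upwards [hKc.isClosed.isOpen_compl.mem_nhds hz] with y hy using hF0 y hy
  have hKt : K ⊆ ψ.target := by
    rintro _ ⟨x, hx, rfl⟩
    exact ψ.map_source (hfψ hx)
  have hFs : ContDiff ℝ 2 F := by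
    rw [contDiff_iff_contDiffAt]
    intro z
    by_cases hz : z ∈ K
    · exact (hf.contDiffAt hψ (hKt hz) (n := 2)).congr_of_eventuallyEq (hFt z (hKt hz))
    · exact contDiffAt_const.congr_of_eventuallyEq (hFn z hz)
  have hint := integral_laplacian_eq_zero hFs (HasCompactSupport.intro hKc hF0)
  rw [← MeasureTheory.setIntegral_eq_integral_of_forall_compl_eq_zero (s := ψ.target)] at hint
  · rw [← hint]
    refine MeasureTheory.setIntegral_congr_fun ψ.open_target.measurableSet fun z hz => ?_
    exact (InnerProductSpace.laplacian_congr_nhds (hFt z hz)).eq_of_nhds.symm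
  · intro z hz
    rw [(InnerProductSpace.laplacian_congr_nhds (hFn z fun h => hz (hKt h))).eq_of_nhds]
    simp

lemma integrableOn_weight_mul_laplacian [CompactSpace X] {φ : OpenPartialHomeomorph X ℂ}
    (hφ : φ ∈ atlas ℂ X) {f w : X → ℝ} (hw : Continuous w) (hf : ChartSmooth f)
    (h : tsupport w ⊆ φ.source ∨ tsupport f ⊆ φ.source) :
    MeasureTheory.IntegrableOn (fun z => w (φ.symm z) * (Δ (f ∘ φ.symm)) z) φ.target := by
  have hc : ContinuousOn (fun z => w (φ.symm z) * (Δ (f ∘ φ.symm)) z) φ.target :=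
    (hw.comp_continuousOn φ.continuousOn_symm).mul
      (continuousOn_laplacian φ.open_target (hf φ hφ))
  rcases h with h | h
  · refine integrableOn_chart_target hc (isClosed_tsupport w) h fun z _ hz => ?_
    rw [image_eq_zero_of_notMem_tsupport hz, zero_mul]
  · refine integrableOn_chart_target hc (isClosed_tsupport f) h fun z hz hzf => ?_
    rw [laplacian_chart_eq_zero hz hzf, mul_zero]

/-- Stokes' theorem `∫_X Δf = 0` on a compact Riemann surface. -/
theorem ChartPartition.integral_laplacian_eq_zero [T2Space X] [CompactSpace X]
    [IsManifold 𝓘(ℂ) ω X] (P : ChartPartition X) {f : X → ℝ} (hf : ChartSmooth f) :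
    P.integral (fun φ => Δ (f ∘ φ.symm)) = 0 := by
  have := isManifold_real (X := X)
  -- the weights of `P` are only continuous, so `f` is cut up by a second, smooth partition of unity
  obtain ⟨ρ, hρ⟩ := SmoothPartitionOfUnity.exists_isSubordinate 𝓘(ℝ, ℂ) (isClosed_univ (X := X))
    (fun i => (P.chart i).source) (fun i => (P.chart i).open_source) (by
      intro x _
      by_contra hx
      have h0 : ∀ i, P.weight i x = 0 := fun i =>
        image_eq_zero_of_notMem_tsupport fun h =>
          hx (Set.mem_iUnion.2 ⟨i, P.tsupport_subset i h⟩)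
      have := P.sum_eq_one x
      simp [h0] at this)
  have hρ1 : ∀ x, ∑ j, ρ j x = 1 := fun x => by
    have := ρ.sum_eq_one (Set.mem_univ x)
    rwa [finsum_eq_sum_of_fintype] at this
  set g : Fin P.n → X → ℝ := fun j x => ρ j x * f x with hg
  have hgs : ∀ j, ChartSmooth (g j) := fun j =>
    (ChartSmooth.of_contMDiff (ρ j).contMDiff).mul hf
  have hgsupp : ∀ j, tsupport (g j) ⊆ (P.chart j).source := fun j =>
    (closure_mono fun x hx => by
      simp only [hg, Function.mem_support, ne_eq, mul_eq_zero, not_or] at hx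
      exact hx.1).trans (hρ j)
  have hsum : ∀ i, ∫ z in (P.chart i).target,
        P.weight i ((P.chart i).symm z) * (Δ (f ∘ (P.chart i).symm)) z =
      ∑ j, ∫ z in (P.chart j).target,
        P.weight i ((P.chart j).symm z) * (Δ (g j ∘ (P.chart j).symm)) z := by
    intro i
    have h1 : ∀ z ∈ (P.chart i).target,
        P.weight i ((P.chart i).symm z) * (Δ (f ∘ (P.chart i).symm)) z =
          ∑ j, P.weight i ((P.chart i).symm z) * (Δ (g j ∘ (P.chart i).symm)) z := by
      intro z hz
      have e : f ∘ (P.chart i).symm = fun w => ∑ j, (g j ∘ (P.chart i).symm) w := by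
        ext w
        simp [hg, ← Finset.sum_mul, hρ1]
      rw [← Finset.mul_sum, e,
        laplacian_finset_sum _ fun j _ => (hgs j).contDiffAt (P.chart_mem i) hz (n := 2)]
    rw [MeasureTheory.setIntegral_congr_fun (P.chart i).open_target.measurableSet h1,
      MeasureTheory.integral_finsetSum _ fun j _ =>
        integrableOn_weight_mul_laplacian (P.chart_mem i) (P.weight i).continuous (hgs j)
          (Or.inl (P.tsupport_subset i))]
    exact Finset.sum_congr rfl fun j _ => setIntegral_laplacian_chart_change (P.chart_mem i)
      (P.chart_mem j) (hgs j) (P.tsupport_subset i) (hgsupp j)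
  unfold ChartPartition.integral
  rw [Finset.sum_congr rfl fun i _ => hsum i, Finset.sum_comm]
  refine Finset.sum_eq_zero fun j _ => ?_
  rw [← MeasureTheory.integral_finsetSum _ fun i _ =>
    integrableOn_weight_mul_laplacian (P.chart_mem j) (P.weight i).continuous (hgs j)
      (Or.inr (hgsupp j))]
  simp_rw [← Finset.sum_mul, P.sum_eq_one, one_mul]
  exact setIntegral_laplacian_chart_eq_zero (P.chart_mem j) (hgs j) (hgsupp j)

end Surface

/-! ### Local frames and coefficients -/

section Coefficients

variable {X : Type*} [TopologicalSpace X] {L : X → Type*} [TopologicalSpace (TotalSpace ℂ L)]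

lemma isOpen_coordDomain (φ : OpenPartialHomeomorph X ℂ) (e : Trivialization ℂ (π ℂ L)) :
    IsOpen (coordDomain φ e) :=
  φ.continuousOn_symm.isOpen_inter_preimage φ.open_target e.open_baseSet

variable [∀ x, TopologicalSpace (L x)] [FiberBundle ℂ L]

lemma chart_mem_coordDomain [ChartedSpace ℂ X] (x : X) :
    chartAt ℂ x x ∈ coordDomain (chartAt ℂ x) (trivializationAt ℂ L x) :=
  ⟨mem_chart_target ℂ x, by simp [FiberBundle.mem_baseSet_trivializationAt']⟩

variable [∀ x, AddCommGroup (L x)] [∀ x, Module ℂ (L x)]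

lemma HermMetric.contDiffAt_coeff [ChartedSpace ℂ X] (h : HermMetric L)
    {φ : OpenPartialHomeomorph X ℂ} (hφ : φ ∈ atlas ℂ X)
    (e : Trivialization ℂ (π ℂ L)) [MemTrivializationAtlas e] {z : ℂ} (hz : z ∈ coordDomain φ e) :
    ContDiffAt ℝ ∞ (h.coeff φ e) z :=
  (h.smooth φ hφ e).contDiffAt ((isOpen_coordDomain φ e).mem_nhds hz)

lemma SecLm2K.analyticAt_coeff [ChartedSpace ℂ X] (β : SecLm2K L) {φ : OpenPartialHomeomorph X ℂ}
    (hφ : φ ∈ atlas ℂ X) (e : Trivialization ℂ (π ℂ L)) [MemTrivializationAtlas e] {z : ℂ}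
    (hz : z ∈ coordDomain φ e) : AnalyticAt ℂ (β.coeff φ e) z :=
  (β.holo φ hφ e).analyticAt ((isOpen_coordDomain φ e).mem_nhds hz)

lemma re_sesq_smul {V : Type*} [AddCommGroup V] [Module ℂ V] (B : V →ₗ⋆[ℂ] V →ₗ[ℂ] ℂ) (t : ℂ)
    (v : V) : (B (t • v) (t • v)).re = ‖t‖ ^ 2 * (B v v).re := by
  simp only [map_smul, map_smulₛₗ, LinearMap.smul_apply, smul_eq_mul]
  rw [← mul_assoc, Complex.mul_conj, ← Complex.normSq_eq_norm_sq, Complex.re_ofReal_mul]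

variable [VectorBundle ℂ ℂ L]

lemma coframe_frame (e : Trivialization ℂ (π ℂ L)) [MemTrivializationAtlas e] {x : X}
    (hx : x ∈ e.baseSet) : coframe e x (frame e x) = 1 :=
  e.linearMapAt_symm hx 1

lemma coframe_smul_frame (e : Trivialization ℂ (π ℂ L)) [MemTrivializationAtlas e] {x : X}
    (hx : x ∈ e.baseSet) (v : L x) : coframe e x v • frame e x = v := by
  have h1 : Function.Injective (coframe e x) := by
    intro a b hab
    have ha := e.symmₗ_linearMapAt (R := ℂ) hx a
    have hb := e.symmₗ_linearMapAt (R := ℂ) hx b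
    rw [← ha, ← hb]
    exact congrArg _ hab
  apply h1
  rw [map_smul, coframe_frame e hx, smul_eq_mul, mul_one]

lemma frame_ne_zero (e : Trivialization ℂ (π ℂ L)) [MemTrivializationAtlas e] {x : X}
    (hx : x ∈ e.baseSet) : frame e x ≠ 0 := fun h => by
  have := coframe_frame e hx
  rw [h, map_zero] at this
  exact zero_ne_one this

/-- The transition between two local frames is multiplication by a nonzero scalar. -/
lemma exists_frame_change (e e' : Trivialization ℂ (π ℂ L)) [MemTrivializationAtlas e]
    [MemTrivializationAtlas e'] {x : X} (hx : x ∈ e.baseSet) (hx' : x ∈ e'.baseSet) :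
    ∃ t : ℂ, t ≠ 0 ∧ frame e' x = t • frame e x ∧ coframe e' x = t⁻¹ • coframe e x := by
  have h1 := (coframe_smul_frame e hx (frame e' x)).symm
  have ht : coframe e x (frame e' x) ≠ 0 := fun h => by
    rw [h, zero_smul] at h1
    exact frame_ne_zero e' hx' h1
  refine ⟨_, ht, h1, ?_⟩
  ext v
  have h2 : coframe e' x (frame e x) = (coframe e x (frame e' x))⁻¹ := by
    have h3 := coframe_frame e' hx'
    rw [h1, map_smul, smul_eq_mul] at h3
    exact eq_inv_of_mul_eq_one_right h3
  rw [LinearMap.smul_apply, smul_eq_mul, ← h2]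
  conv_lhs => rw [← coframe_smul_frame e hx v, map_smul, smul_eq_mul]
  ring

variable [ChartedSpace ℂ X]

lemma coordVec_ne_zero [IsManifold 𝓘(ℂ) ω X] {φ : OpenPartialHomeomorph X ℂ} (hφ : φ ∈ atlas ℂ X)
    {z : ℂ} (hz : z ∈ φ.target) : coordVec φ z ≠ 0 := by
  intro h
  have h1 := (mdifferentiable_of_mem_atlas (I := 𝓘(ℂ)) hφ
    (M := X)).comp_symm_deriv hz
  have h2 := congrArg (fun T => T (1 : ℂ)) h1
  have h3 : mfderiv 𝓘(ℂ) 𝓘(ℂ) φ.symm z (1 : ℂ) = 0 := h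
  erw [ContinuousLinearMap.comp_apply, h3] at h2
  erw [map_zero] at h2
  exact zero_ne_one (α := ℂ) h2

namespace HermMetric

lemma coeff_pos (h : HermMetric L) {φ : OpenPartialHomeomorph X ℂ} (e : Trivialization ℂ (π ℂ L))
    [MemTrivializationAtlas e] {z : ℂ} (hz : z ∈ coordDomain φ e) : 0 < h.coeff φ e z :=
  h.pos _ _ (frame_ne_zero e hz.2)

lemma contDiffAt_log_coeff (h : HermMetric L) {φ : OpenPartialHomeomorph X ℂ}
    (hφ : φ ∈ atlas ℂ X) (e : Trivialization ℂ (π ℂ L)) [MemTrivializationAtlas e] {z : ℂ}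
    (hz : z ∈ coordDomain φ e) : ContDiffAt ℝ ∞ (fun w => Real.log (h.coeff φ e w)) z :=
  (h.contDiffAt_coeff hφ e hz).log (h.coeff_pos e hz).ne'

end HermMetric

/-! ### The degree and flat metrics -/

/-- The function `log (k / h)` comparing two metrics. -/
def logRatio (k h : HermMetric L) (x : X) : ℝ :=
  Real.log ((k.form x (frame (trivializationAt ℂ L x) x) (frame (trivializationAt ℂ L x) x)).re /
    (h.form x (frame (trivializationAt ℂ L x) x) (frame (trivializationAt ℂ L x) x)).re)

lemma logRatio_apply_symm (k h : HermMetric L) {φ : OpenPartialHomeomorph X ℂ}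
    (e : Trivialization ℂ (π ℂ L)) [MemTrivializationAtlas e] {z : ℂ} (hz : z ∈ coordDomain φ e) :
    logRatio k h (φ.symm z) = Real.log (k.coeff φ e z) - Real.log (h.coeff φ e z) := by
  obtain ⟨t, ht, h1, -⟩ := exists_frame_change e (trivializationAt ℂ L (φ.symm z)) hz.2
    (FiberBundle.mem_baseSet_trivializationAt' _)
  rw [← Real.log_div (k.coeff_pos e hz).ne' (h.coeff_pos e hz).ne', logRatio, h1,
    re_sesq_smul, re_sesq_smul,
    mul_div_mul_left _ _ (pow_ne_zero 2 (norm_ne_zero_iff.2 ht))]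
  rfl

lemma chartSmooth_logRatio (k h : HermMetric L) : ChartSmooth (logRatio k h) := by
  intro φ hφ z hz
  set e := trivializationAt ℂ L (φ.symm z)
  have hze : z ∈ coordDomain φ e := ⟨hz, FiberBundle.mem_baseSet_trivializationAt' _⟩
  refine ContDiffAt.contDiffWithinAt (ContDiffAt.congr_of_eventuallyEq
    ((k.contDiffAt_log_coeff hφ e hze).sub (h.contDiffAt_log_coeff hφ e hze)) ?_)
  filter_upwards [(isOpen_coordDomain φ e).mem_nhds hze] with w hw
  exact logRatio_apply_symm k h e hw

/-- A line bundle with a flat metric has degree zero: the Chern form of any other metric is the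
Laplacian of a globally defined function. -/
theorem HasDegree.eq_zero_of_flat [T2Space X] [CompactSpace X] [IsManifold 𝓘(ℂ) ω X] {d : ℤ}
    (hd : HasDegree L d) (h : HermMetric L)
    (hflat : ∀ φ ∈ atlas ℂ X, ∀ (e : Trivialization ℂ (π ℂ L)) [MemTrivializationAtlas e],
      ∀ z ∈ coordDomain φ e, dzbarDz (fun w => Real.log (h.coeff φ e w)) z = 0) : d = 0 := by
  obtain ⟨k, P, hP⟩ := hd
  have key : ∀ φ ∈ atlas ℂ X, ∀ z ∈ φ.target, chernDensity k φ z =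
      -(1 / Real.pi) * (1 / 4) * (Δ (logRatio k h ∘ φ.symm)) z := by
    intro φ hφ z hz
    set e := trivializationAt ℂ L (φ.symm z) with he
    have hze : z ∈ coordDomain φ e := ⟨hz, FiberBundle.mem_baseSet_trivializationAt' _⟩
    have h1 : logRatio k h ∘ φ.symm =ᶠ[𝓝 z] (fun w => Real.log (k.coeff φ e w)) -
        fun w => Real.log (h.coeff φ e w) := by
      filter_upwards [(isOpen_coordDomain φ e).mem_nhds hze] with w hw using
        logRatio_apply_symm k h e hw
    have h2 := hflat φ hφ e z hze
    rw [dzbarDz] at h2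
    have h3 : ∀ m : HermMetric L, ContDiffAt ℝ 2 (fun w => Real.log (m.coeff φ e w)) z :=
      fun m => (m.contDiffAt_log_coeff hφ e hze).of_le (by norm_cast)
    rw [(InnerProductSpace.laplacian_congr_nhds h1).eq_of_nhds, (h3 k).laplacian_sub (h3 h),
      chernDensity, dzbarDz]
    linear_combination -(1 / Real.pi) * h2
  have hint : P.integral (chernDensity k) =
      -(1 / Real.pi) * (1 / 4) * P.integral (fun φ => Δ (logRatio k h ∘ φ.symm)) := by
    simp only [ChartPartition.integral, Finset.mul_sum]
    refine Finset.sum_congr rfl fun i _ => ?_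
    rw [← MeasureTheory.integral_const_mul]
    refine MeasureTheory.setIntegral_congr_fun (P.chart i).open_target.measurableSet
      fun z hz => ?_
    simp only [key _ (P.chart_mem i) z hz]
    ring
  rw [P.integral_laplacian_eq_zero (chartSmooth_logRatio k h), mul_zero, hP] at hint
  exact_mod_cast hint

end Coefficients

/-! ### The quotient `|α h² / β|` -/

section Quotient

variable {X : Type*} [TopologicalSpace X] [ChartedSpace ℂ X]
variable {L : X → Type*} [∀ x, AddCommGroup (L x)] [∀ x, Module ℂ (L x)]
  [∀ x, TopologicalSpace (L x)] [TopologicalSpace (TotalSpace ℂ L)] [FiberBundle ℂ L]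
  [VectorBundle ℂ ℂ L]

lemma SecL2K.analyticAt_coeff (α : SecL2K L) {φ : OpenPartialHomeomorph X ℂ} (hφ : φ ∈ atlas ℂ X)
    (e : Trivialization ℂ (π ℂ L)) [MemTrivializationAtlas e] {z : ℂ} (hz : z ∈ coordDomain φ e) :
    AnalyticAt ℂ (α.coeff φ e) z :=
  (α.holo φ hφ e).analyticAt ((isOpen_coordDomain φ e).mem_nhds hz)

/-- A nonzero tangent vector at the point `x`: the number `1`, under the identification of the
tangent space with `ℂ`. -/
def unitVec (x : X) : TangentSpace 𝓘(ℂ) x := (1 : ℂ)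

lemma exists_eq_smul_of_tangent_ne_zero {x : X} {τ : TangentSpace 𝓘(ℂ) x} (hτ : τ ≠ 0)
    (σ : TangentSpace 𝓘(ℂ) x) : ∃ c : ℂ, σ = c • τ := by
  have h : ∀ a b : ℂ, a ≠ 0 → ∃ c : ℂ, b = c • a := fun a b ha =>
    ⟨b / a, (div_mul_cancel₀ b ha).symm⟩
  exact h τ σ hτ

lemma unitVec_ne_zero (x : X) : unitVec x ≠ 0 := one_ne_zero (α := ℂ)

/-- The value of `|α h² / β|` at a point, computed with `unitVec` and the preferred frame; it does
not depend on this choice (`quotientNorm_apply_symm`). Where `β` vanishes it has the junk value `0`,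
which need not be the limit. -/
def quotientNorm (α : SecL2K L) (β : SecLm2K L) (h : HermMetric L) (x : X) : ℝ :=
  ‖coframe (trivializationAt ℂ L x) x
        (α.toFun x (unitVec x) (coframe (trivializationAt ℂ L x) x))‖ *
      (h.form x (frame (trivializationAt ℂ L x) x) (frame (trivializationAt ℂ L x) x)).re ^ 2 /
    ‖β.toFun x (unitVec x) (frame (trivializationAt ℂ L x) x) (frame (trivializationAt ℂ L x) x)‖

lemma quotientNorm_apply_symm [IsManifold 𝓘(ℂ) ω X] (α : SecL2K L) (β : SecLm2K L)
    (h : HermMetric L) {φ : OpenPartialHomeomorph X ℂ} (hφ : φ ∈ atlas ℂ X)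
    (e : Trivialization ℂ (π ℂ L)) [MemTrivializationAtlas e] {z : ℂ} (hz : z ∈ coordDomain φ e) :
    quotientNorm α β h (φ.symm z) =
      ‖α.coeff φ e z‖ * h.coeff φ e z ^ 2 / ‖β.coeff φ e z‖ := by
  obtain ⟨t, ht, h1, h2⟩ := exists_frame_change (trivializationAt ℂ L (φ.symm z)) e
    (FiberBundle.mem_baseSet_trivializationAt' _) hz.2
  have hc := coordVec_ne_zero hφ hz.1
  unfold quotientNorm SecL2K.coeff SecLm2K.coeff HermMetric.coeff
  rw [h1, h2, re_sesq_smul]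
  generalize coordVec φ z = τ at hc
  obtain ⟨c, hτ⟩ := exists_eq_smul_of_tangent_ne_zero (unitVec_ne_zero (φ.symm z)) τ
  have hc' : c ≠ 0 := fun h0 => hc (by rw [hτ, h0, zero_smul])
  rw [hτ]
  simp only [map_smul, LinearMap.smul_apply, smul_eq_mul, norm_mul, norm_inv]
  have ht' := norm_ne_zero_iff.2 ht
  have hc'' := norm_ne_zero_iff.2 hc'
  generalize ‖t‖ = T at *
  generalize ‖c‖ = C at *
  -- a frame change by `t` multiplies `|α|`, `h²`, `|β|` by `|t|⁻²`, `|t|⁴`, `|t|²`, and a change of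
  -- tangent vector by `c` multiplies `|α|` and `|β|` by `|c|`
  rw [show ∀ a b k : ℝ, T⁻¹ * (C * (T⁻¹ * a)) * (T ^ 2 * b) ^ 2 / (T * (T * (C * k))) =
    (T⁻¹ * T) ^ 2 * (T * T⁻¹) ^ 2 * (C * C⁻¹) * (a * b ^ 2 / k) by
      intro a b k; rw [div_eq_mul_inv, div_eq_mul_inv]; simp only [mul_inv]; ring]
  simp [inv_mul_cancel₀ ht', mul_inv_cancel₀ ht', mul_inv_cancel₀ hc'']

/-- A section vanishes at a point if and only if its coefficient does. -/
lemma SecLm2K.coeff_eq_zero_iff [IsManifold 𝓘(ℂ) ω X] (β : SecLm2K L)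
    {φ : OpenPartialHomeomorph X ℂ} (hφ : φ ∈ atlas ℂ X)
    (e : Trivialization ℂ (π ℂ L)) [MemTrivializationAtlas e] {z : ℂ} (hz : z ∈ coordDomain φ e) :
    β.coeff φ e z = 0 ↔ β.toFun (φ.symm z) = 0 := by
  constructor
  · intro h
    have hc := coordVec_ne_zero hφ hz.1
    unfold SecLm2K.coeff at h
    generalize coordVec φ z = τ at hc h
    refine LinearMap.ext fun σ => ?_
    obtain ⟨c, hσ⟩ := exists_eq_smul_of_tangent_ne_zero hc σ
    refine LinearMap.ext fun v => LinearMap.ext fun w => ?_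
    rw [hσ, ← coframe_smul_frame e hz.2 v, ← coframe_smul_frame e hz.2 w]
    simp [h]
  · intro h
    simp [SecLm2K.coeff, h]

/-- The zeros of a nonzero holomorphic section are isolated. -/
lemma SecLm2K.eventually_ne_zero [ConnectedSpace X] [IsManifold 𝓘(ℂ) ω X] (β : SecLm2K L)
    (hβ : ∃ x, β.toFun x ≠ 0) (x : X) : ∀ᶠ y in 𝓝[≠] x, β.toFun y ≠ 0 := by
  -- near any point, `β` either vanishes identically or only at that point
  have hdich : ∀ x, (∀ᶠ y in 𝓝 x, β.toFun y = 0) ∨ ∀ᶠ y in 𝓝[≠] x, β.toFun y ≠ 0 := by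
    intro x
    set φ := chartAt ℂ x
    set e := trivializationAt ℂ L x
    have hφ : φ ∈ atlas ℂ X := chart_mem_atlas ℂ x
    have hz := chart_mem_coordDomain (L := L) x
    have hdom : ∀ᶠ y in 𝓝 x, y ∈ φ.source ∧ φ y ∈ coordDomain φ e :=
      Filter.inter_mem (φ.open_source.mem_nhds (mem_chart_source ℂ x))
        ((φ.continuousAt (mem_chart_source ℂ x)).eventually
          ((isOpen_coordDomain φ e).mem_nhds hz))
    have hiff : ∀ y, y ∈ φ.source ∧ φ y ∈ coordDomain φ e →
        (β.coeff φ e (φ y) = 0 ↔ β.toFun y = 0) := by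
      rintro y ⟨h1, h2⟩
      rw [β.coeff_eq_zero_iff hφ e h2, φ.left_inv h1]
    rcases (β.analyticAt_coeff hφ e hz).eventually_eq_zero_or_eventually_ne_zero with h | h
    · left
      filter_upwards [hdom, (φ.continuousAt (mem_chart_source ℂ x)).eventually h] with y h1 h2
      exact (hiff y h1).1 h2
    · right
      rw [eventually_nhdsWithin_iff] at h ⊢
      filter_upwards [hdom, (φ.continuousAt (mem_chart_source ℂ x)).eventually h] with y h1 h2 hy
      rw [Ne, ← hiff y h1]
      exact h2 fun h3 => hy (φ.injOn h1.1 (mem_chart_source ℂ x) h3)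
  set A : Set X := {x | ∀ᶠ y in 𝓝 x, β.toFun y = 0} with hA
  have hAo : IsOpen A := isOpen_iff_mem_nhds.2 fun x hx =>
    (eventually_eventually_nhds.2 hx : ∀ᶠ y in 𝓝 x, ∀ᶠ y' in 𝓝 y, β.toFun y' = 0)
  have hAc : IsClosed A := by
    rw [← isOpen_compl_iff, isOpen_iff_mem_nhds]
    intro x hx
    have h := (hdich x).resolve_left hx
    rw [eventually_nhdsWithin_iff] at h
    filter_upwards [h] with y hy hyA
    by_cases hyx : y = x
    · exact hx (hyx ▸ hyA)
    · exact hy hyx (show ∀ᶠ y' in 𝓝 y, β.toFun y' = 0 from hyA).self_of_nhds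
  rcases isClopen_iff.1 ⟨hAc, hAo⟩ with h | h
  · exact (hdich x).resolve_left fun hx => (h ▸ (show x ∈ A from hx) : x ∈ (∅ : Set X))
  · obtain ⟨y, hy⟩ := hβ
    have : y ∈ A := h ▸ Set.mem_univ y
    exact absurd (show ∀ᶠ y' in 𝓝 y, β.toFun y' = 0 from this).self_of_nhds hy

lemma SecLm2K.eventually_coeff_ne_zero [ConnectedSpace X] [IsManifold 𝓘(ℂ) ω X] (β : SecLm2K L)
    (hβ : ∃ x, β.toFun x ≠ 0) {φ : OpenPartialHomeomorph X ℂ} (hφ : φ ∈ atlas ℂ X)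
    (e : Trivialization ℂ (π ℂ L)) [MemTrivializationAtlas e] {z : ℂ} (hz : z ∈ coordDomain φ e) :
    ∀ᶠ w in 𝓝 z, w ≠ z → β.coeff φ e w ≠ 0 := by
  have h1 := β.eventually_ne_zero hβ (φ.symm z)
  rw [eventually_nhdsWithin_iff] at h1
  filter_upwards [(φ.continuousAt_symm hz.1).eventually h1,
    (isOpen_coordDomain φ e).mem_nhds hz] with w h2 h3 hwz
  rw [Ne, β.coeff_eq_zero_iff hφ e h3]
  exact h2 fun h4 => hwz (φ.symm.injOn h3.1 hz.1 h4)

/-- The condition `Div α ≥ Div β` makes `|α h² / β|` extend continuously over the zeros of `β`. -/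
lemma exists_continuous_quotient [ConnectedSpace X] [IsManifold 𝓘(ℂ) ω X] (α : SecL2K L)
    (β : SecLm2K L) (hβ : ∃ x, β.toFun x ≠ 0) (hdiv : ∀ x, β.div x ≤ α.div x) (h : HermMetric L) :
    ∃ q : X → ℝ, Continuous q ∧ ∀ x, β.toFun x ≠ 0 → q x = quotientNorm α β h x := by
  have hG : ∀ x : X, ∃ G : ℂ → ℂ, AnalyticAt ℂ G (chartAt ℂ x x) ∧
      ∀ᶠ z in 𝓝 (chartAt ℂ x x), α.coeff (chartAt ℂ x) (trivializationAt ℂ L x) z =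
        G z * β.coeff (chartAt ℂ x) (trivializationAt ℂ L x) z := by
    intro x
    have hz := chart_mem_coordDomain (L := L) x
    have hβa := β.analyticAt_coeff (chart_mem_atlas ℂ x) (trivializationAt ℂ L x) hz
    have hαa := α.analyticAt_coeff (chart_mem_atlas ℂ x) (trivializationAt ℂ L x) hz
    have htop : β.div x ≠ ⊤ := by
      intro htop
      rw [SecLm2K.div, analyticOrderAt_eq_top] at htop
      have h1 : ∀ᶠ w in 𝓝[≠] chartAt ℂ x x,
          β.coeff (chartAt ℂ x) (trivializationAt ℂ L x) w ≠ 0 :=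
        eventually_nhdsWithin_iff.2 (β.eventually_coeff_ne_zero hβ (chart_mem_atlas ℂ x)
        (trivializationAt ℂ L x) hz)
      obtain ⟨w, h2, h3⟩ := (h1.and (htop.filter_mono nhdsWithin_le_nhds)).exists
      exact h2 h3
    obtain ⟨n, hn⟩ := ENat.ne_top_iff_exists.1 htop
    obtain ⟨b, hb, hb0, hbe⟩ := (hβa.analyticOrderAt_eq_natCast (n := n)).1 hn.symm
    obtain ⟨a, ha, hae⟩ := (natCast_le_analyticOrderAt (n := n) hαa).1 (hn ▸ hdiv x)
    refine ⟨fun z => a z / b z, ha.div hb hb0, ?_⟩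
    filter_upwards [hbe, hae, hb.continuousAt.eventually_ne hb0] with z h1 h2 h3
    rw [h1, h2]
    simp only [smul_eq_mul]
    field_simp
  choose G hGa hG using hG
  set r : X → X → ℝ := fun x y => ‖G x (chartAt ℂ x y)‖ *
    h.coeff (chartAt ℂ x) (trivializationAt ℂ L x) (chartAt ℂ x y) ^ 2 with hr
  have hrq : ∀ x, ∀ᶠ y in 𝓝 x, β.toFun y ≠ 0 → r x y = quotientNorm α β h y := by
    intro x
    have hx := mem_chart_source ℂ x
    have hz := chart_mem_coordDomain (L := L) x
    filter_upwards [(chartAt ℂ x).open_source.mem_nhds hx,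
      ((chartAt ℂ x).continuousAt hx).eventually (hG x),
      ((chartAt ℂ x).continuousAt hx).eventually ((isOpen_coordDomain _ _).mem_nhds hz)]
      with y h1 h2 h3 hy
    have h4 := quotientNorm_apply_symm α β h (chart_mem_atlas ℂ x) _ h3
    have h5 := β.coeff_eq_zero_iff (chart_mem_atlas ℂ x) _ h3
    rw [(chartAt ℂ x).left_inv h1] at h4 h5
    have h6 := norm_ne_zero_iff.2 (mt h5.1 hy)
    rw [h4, h2, norm_mul, hr]
    field_simp
  have hq : ∀ x, β.toFun x ≠ 0 → r x x = quotientNorm α β h x := fun x =>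
    (hrq x).self_of_nhds
  refine ⟨fun x => r x x, ?_, hq⟩
  rw [continuous_iff_continuousAt]
  intro x
  have hc : ContinuousAt (r x) x := by
    have hx := (chartAt ℂ x).continuousAt (mem_chart_source ℂ x)
    have h1 : ContinuousAt (fun y => G x (chartAt ℂ x y)) x :=
      (hGa x).continuousAt.comp hx
    have h2 : ContinuousAt (fun y => h.coeff (chartAt ℂ x) (trivializationAt ℂ L x)
        (chartAt ℂ x y)) x :=
      (h.contDiffAt_coeff (chart_mem_atlas ℂ x) _
        (chart_mem_coordDomain (L := L) x)).continuousAt.comp hx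
    exact h1.norm.mul (h2.pow 2)
  refine hc.congr ?_
  have h1 := β.eventually_ne_zero hβ x
  rw [eventually_nhdsWithin_iff] at h1
  filter_upwards [h1, hrq x] with y h2 h3
  by_cases hyx : y = x
  · rw [hyx]
  · rw [h3 (h2 hyx), hq y (h2 hyx)]

/-- In every chart and frame, `α = G β` with `G` holomorphic, also at the zeros of `β`. The order
of vanishing in an arbitrary chart is not compared with that in the preferred one: since
`|α / β| = q h⁻²` is bounded, the singularities of `α / β` are removable. -/
lemma exists_analytic_quotient [ConnectedSpace X] [IsManifold 𝓘(ℂ) ω X] {α : SecL2K L}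
    {β : SecLm2K L} (hβ : ∃ x, β.toFun x ≠ 0) {h : HermMetric L} {q : X → ℝ} (hqc : Continuous q)
    (hq : ∀ x, β.toFun x ≠ 0 → q x = quotientNorm α β h x)
    {φ : OpenPartialHomeomorph X ℂ} (hφ : φ ∈ atlas ℂ X)
    (e : Trivialization ℂ (π ℂ L)) [MemTrivializationAtlas e] {z : ℂ} (hz : z ∈ coordDomain φ e) :
    ∃ G : ℂ → ℂ, AnalyticAt ℂ G z ∧ (∀ᶠ w in 𝓝 z, α.coeff φ e w = G w * β.coeff φ e w) ∧
      ∀ᶠ w in 𝓝 z, q (φ.symm w) = ‖G w‖ * h.coeff φ e w ^ 2 := by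
  set f : ℂ → ℂ := fun w => α.coeff φ e w / β.coeff φ e w with hf
  have hdom := (isOpen_coordDomain φ e).mem_nhds hz
  have hqφ : ContinuousAt (fun w => q (φ.symm w)) z :=
    hqc.continuousAt.comp (φ.continuousAt_symm hz.1)
  have hhc := (h.contDiffAt_coeff hφ e hz).continuousAt
  have hh0 := h.coeff_pos e hz
  have hne := β.eventually_coeff_ne_zero hβ hφ e hz
  have hfq : ∀ w ∈ coordDomain φ e, β.coeff φ e w ≠ 0 →
      q (φ.symm w) = ‖f w‖ * h.coeff φ e w ^ 2 := by
    intro w hw hw0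
    rw [hq _ (mt (β.coeff_eq_zero_iff hφ e hw).2 hw0), quotientNorm_apply_symm α β h hφ e hw, hf,
      norm_div]
    ring
  -- `|f| = q h⁻²` is bounded near `z`
  obtain ⟨C, hC⟩ : ∃ C : ℝ, ∀ᶠ w in 𝓝 z, q (φ.symm w) / h.coeff φ e w ^ 2 < C := by
    have : ContinuousAt (fun w => q (φ.symm w) / h.coeff φ e w ^ 2) z :=
      hqφ.div (hhc.pow 2) (by positivity)
    exact ⟨_, this.eventually (gt_mem_nhds (lt_add_one _))⟩
  set s : Set ℂ := {w | w ∈ coordDomain φ e ∧ (w ≠ z → β.coeff φ e w ≠ 0) ∧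
    q (φ.symm w) / h.coeff φ e w ^ 2 < C} with hs
  have hsn : s ∈ 𝓝 z := Filter.inter_mem hdom (hne.and hC)
  have hfd : DifferentiableOn ℂ f (s \ {z}) := by
    rintro w ⟨⟨h1, h2, -⟩, h3⟩
    exact ((α.analyticAt_coeff hφ e h1).differentiableAt.div
      (β.analyticAt_coeff hφ e h1).differentiableAt (h2 h3)).differentiableWithinAt
  have hfb : BddAbove (norm ∘ f '' (s \ {z})) := by
    refine ⟨C, ?_⟩
    rintro _ ⟨w, ⟨⟨h1, h2, h3⟩, h4⟩, rfl⟩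
    have h5 := (h.coeff_pos e h1).ne'
    rw [hfq w h1 (h2 h4), mul_div_cancel_right₀ _ (pow_ne_zero 2 h5)] at h3
    exact h3.le
  have hGd := Complex.differentiableOn_update_limUnder_of_bddAbove hsn hfd hfb
  set G := Function.update f z ((𝓝[≠] z).limUnder f) with hG
  have hGa : AnalyticAt ℂ G z := hGd.analyticAt hsn
  have hGf : ∀ w, w ≠ z → G w = f w := fun w hw => Function.update_of_ne hw _ _
  refine ⟨G, hGa, ?_, ?_⟩
  · refine (ContinuousAt.eventuallyEq_nhds_iff_eventuallyEq_nhdsNE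
      (α.analyticAt_coeff hφ e hz).continuousAt
      (hGa.mul (β.analyticAt_coeff hφ e hz)).continuousAt).1 ?_
    refine eventually_nhdsWithin_iff.2 ?_
    filter_upwards [hne] with w h1 h2
    rw [Pi.mul_apply, hGf w h2, hf, div_mul_cancel₀ _ (h1 h2)]
  · refine (ContinuousAt.eventuallyEq_nhds_iff_eventuallyEq_nhdsNE hqφ
      (hGa.continuousAt.norm.mul (hhc.pow 2))).1 ?_
    refine eventually_nhdsWithin_iff.2 ?_
    filter_upwards [hne, hdom] with w h1 h3 h2
    simp only [Pi.mul_apply, Pi.pow_apply]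
    rw [hGf w h2]
    exact hfq w h3 (h1 h2)

/-- Since `log |G|` is harmonic, the Laplacian of `log q²` is that of `4 log h`. -/
lemma dzbarDz_log_sq_quotient {φ : OpenPartialHomeomorph X ℂ} (hφ : φ ∈ atlas ℂ X)
    (e : Trivialization ℂ (π ℂ L)) [MemTrivializationAtlas e] {z : ℂ} (hz : z ∈ coordDomain φ e)
    {h : HermMetric L} {q : X → ℝ} {G : ℂ → ℂ} (hG : AnalyticAt ℂ G z) (hG0 : G z ≠ 0)
    (hqG : ∀ᶠ w in 𝓝 z, q (φ.symm w) = ‖G w‖ * h.coeff φ e w ^ 2) :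
    ContDiffAt ℝ ∞ (fun w => Real.log (q (φ.symm w) ^ 2)) z ∧
      dzbarDz (fun w => Real.log (q (φ.symm w) ^ 2)) z =
        4 * dzbarDz (fun w => Real.log (h.coeff φ e w)) z := by
  have h1 : (fun w => Real.log (q (φ.symm w) ^ 2)) =ᶠ[𝓝 z]
      (2 : ℝ) • (fun w => Real.log ‖G w‖) + (4 : ℝ) • fun w => Real.log (h.coeff φ e w) := by
    filter_upwards [hqG, hG.continuousAt.eventually_ne hG0,
      (isOpen_coordDomain φ e).mem_nhds hz] with w h2 h3 h4
    have h5 := (h.coeff_pos e h4).ne'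
    rw [h2, Real.log_pow, Real.log_mul (norm_ne_zero_iff.2 h3) (pow_ne_zero 2 h5), Real.log_pow]
    simp only [Pi.add_apply, Pi.smul_apply, smul_eq_mul]
    push_cast
    ring
  have hGs : ContDiffAt ℝ ∞ (fun w => Real.log ‖G w‖) z :=
    ((hG.contDiffAt.restrict_scalars ℝ).norm ℝ hG0).log (norm_ne_zero_iff.2 hG0)
  have hhs := h.contDiffAt_log_coeff hφ e hz
  refine ⟨((contDiffAt_const.smul hGs).add (contDiffAt_const.smul hhs)).congr_of_eventuallyEq h1,
    ?_⟩
  have hG2 : ContDiffAt ℝ 2 (fun w => Real.log ‖G w‖) z := hGs.of_le (by norm_cast)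
  have hh2 : ContDiffAt ℝ 2 (fun w => Real.log (h.coeff φ e w)) z := hhs.of_le (by norm_cast)
  have hG2' : ContDiffAt ℝ 2 ((2 : ℝ) • fun w => Real.log ‖G w‖) z := contDiffAt_const.smul hG2
  have hh2' : ContDiffAt ℝ 2 ((4 : ℝ) • fun w => Real.log (h.coeff φ e w)) z :=
    contDiffAt_const.smul hh2
  have hharm : (Δ (fun w => Real.log ‖G w‖)) z = 0 :=
    (hG.harmonicAt_log_norm hG0).2.self_of_nhds
  rw [dzbarDz, dzbarDz, (InnerProductSpace.laplacian_congr_nhds h1).eq_of_nhds,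
    hG2'.laplacian_add hh2', InnerProductSpace.laplacian_smul _ hG2,
    InnerProductSpace.laplacian_smul _ hh2, hharm]
  simp only [smul_eq_mul]
  ring

end Quotient

/-! ### The maximum principle for the quotient -/

section Maximum

variable {X : Type*} [TopologicalSpace X] [ChartedSpace ℂ X]
variable {L : X → Type*} [∀ x, AddCommGroup (L x)] [∀ x, Module ℂ (L x)]
  [∀ x, TopologicalSpace (L x)] [TopologicalSpace (TotalSpace ℂ L)] [FiberBundle ℂ L]
  [VectorBundle ℂ ℂ L]

/-- Combined with the vortex equation, this gives the sinh-Gordon equation; it is kept in a form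
that makes sense at the zeros of `q`. -/
lemma vortex_rhs_eq {R : ℝ} {α : SecL2K L} {β : SecLm2K L} {h : HermMetric L}
    (hh : SolvesVortex R α β h) {φ : OpenPartialHomeomorph X ℂ} (hφ : φ ∈ atlas ℂ X)
    (e : Trivialization ℂ (π ℂ L)) [MemTrivializationAtlas e] {z : ℂ} (hz : z ∈ coordDomain φ e)
    {t : ℝ} (ht : ‖α.coeff φ e z‖ * h.coeff φ e z ^ 2 = t * ‖β.coeff φ e z‖) :
    dzbarDz (fun w => Real.log (h.coeff φ e w)) z =
      R ^ 2 * (‖β.coeff φ e z‖ ^ 2 / h.coeff φ e z ^ 2) * (t ^ 2 - 1) := by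
  have h0 := (h.coeff_pos e hz).ne'
  have ha : ‖α.coeff φ e z‖ = t * ‖β.coeff φ e z‖ / h.coeff φ e z ^ 2 := by
    rw [← ht]; field_simp
  rw [hh φ hφ e z hz, ha]
  field_simp

/-- The properties of `q = |α h² / β|` in a chart and a frame that do not involve the auxiliary
function `α / β`. -/
lemma quotient_chart_properties [ConnectedSpace X] [IsManifold 𝓘(ℂ) ω X] {α : SecL2K L}
    {β : SecLm2K L} (hβ : ∃ x, β.toFun x ≠ 0) {h : HermMetric L} {q : X → ℝ} (hqc : Continuous q)
    (hq : ∀ x, β.toFun x ≠ 0 → q x = quotientNorm α β h x)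
    {φ : OpenPartialHomeomorph X ℂ} (hφ : φ ∈ atlas ℂ X)
    (e : Trivialization ℂ (π ℂ L)) [MemTrivializationAtlas e] {z : ℂ} (hz : z ∈ coordDomain φ e) :
    0 ≤ q (φ.symm z) ∧
      ‖α.coeff φ e z‖ * h.coeff φ e z ^ 2 = q (φ.symm z) * ‖β.coeff φ e z‖ ∧
      (q (φ.symm z) ≠ 0 → ContDiffAt ℝ ∞ (fun w => Real.log (q (φ.symm w) ^ 2)) z ∧
        dzbarDz (fun w => Real.log (q (φ.symm w) ^ 2)) z =
          4 * dzbarDz (fun w => Real.log (h.coeff φ e w)) z) := by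
  obtain ⟨G, hG, hαG, hqG⟩ := exists_analytic_quotient hβ hqc hq hφ e hz
  have h1 := hqG.self_of_nhds
  refine ⟨by rw [h1]; positivity, ?_, fun h0 => ?_⟩
  · rw [h1, hαG.self_of_nhds, norm_mul]
    ring
  · refine dzbarDz_log_sq_quotient hφ e hz hG (fun h2 => h0 ?_) hqG
    rw [h1, h2, norm_zero, zero_mul]

lemma quotient_nonneg [ConnectedSpace X] [IsManifold 𝓘(ℂ) ω X] {α : SecL2K L}
    {β : SecLm2K L} (hβ : ∃ x, β.toFun x ≠ 0) {h : HermMetric L} {q : X → ℝ} (hqc : Continuous q)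
    (hq : ∀ x, β.toFun x ≠ 0 → q x = quotientNorm α β h x) (x : X) : 0 ≤ q x := by
  have := (quotient_chart_properties hβ hqc hq (chart_mem_atlas ℂ x) (trivializationAt ℂ L x)
    (chart_mem_coordDomain x)).1
  rwa [(chartAt ℂ x).left_inv (mem_chart_source ℂ x)] at this

/-- If `q` attains a maximum `M ≥ 1` at `x₀`, then `q = M` near `x₀`: the function
`v = log M² - log q²` is nonnegative, vanishes at `x₀`, and satisfies
`Δv = 16 R² |β|² h⁻² (1 - M² e⁻ᵛ) ≤ 16 R² |β|² h⁻² v`. -/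
lemma eventually_eq_of_one_le_max [ConnectedSpace X] [IsManifold 𝓘(ℂ) ω X] {R : ℝ}
    {α : SecL2K L} {β : SecLm2K L} (hβ : ∃ x, β.toFun x ≠ 0) {h : HermMetric L}
    (hh : SolvesVortex R α β h) {q : X → ℝ} (hqc : Continuous q)
    (hq : ∀ x, β.toFun x ≠ 0 → q x = quotientNorm α β h x) {x₀ : X} (h1 : 1 ≤ q x₀)
    (hmax : ∀ x, q x ≤ q x₀) : ∀ᶠ x in 𝓝 x₀, q x = q x₀ := by
  set φ := chartAt ℂ x₀
  set e := trivializationAt ℂ L x₀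
  have hφ : φ ∈ atlas ℂ X := chart_mem_atlas ℂ x₀
  have hz : φ x₀ ∈ coordDomain φ e := chart_mem_coordDomain x₀
  have hx₀ : φ.symm (φ x₀) = x₀ := φ.left_inv (mem_chart_source ℂ x₀)
  set c : ℂ → ℝ := fun w => 16 * R ^ 2 * (‖β.coeff φ e w‖ ^ 2 / h.coeff φ e w ^ 2) with hc
  have hcc : ContinuousAt c (φ x₀) :=
    continuousAt_const.mul (((β.analyticAt_coeff hφ e hz).continuousAt.norm.pow 2).div
      ((h.contDiffAt_coeff hφ e hz).continuousAt.pow 2) (pow_ne_zero 2 (h.coeff_pos e hz).ne'))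
  have hc0 : ∀ w, 0 ≤ c w := fun w => by positivity
  set C : ℝ := c (φ x₀) + 1 with hC
  have hCpos : 0 < C := by have := hc0 (φ x₀); positivity
  have hqφ : ContinuousAt (fun w => q (φ.symm w)) (φ x₀) :=
    hqc.continuousAt.comp (φ.continuousAt_symm hz.1)
  have hev : ∀ᶠ w in 𝓝 (φ x₀), w ∈ coordDomain φ e ∧ c w < C ∧ 0 < q (φ.symm w) := by
    refine Filter.inter_mem ((isOpen_coordDomain φ e).mem_nhds hz) (Filter.inter_mem
      (hcc.eventually (gt_mem_nhds (lt_add_one _))) (hqφ.eventually (lt_mem_nhds ?_)))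
    beta_reduce
    rw [hx₀]
    linarith
  obtain ⟨δ, hδ, hball⟩ := Metric.eventually_nhds_iff_ball.1 hev
  obtain ⟨ρ, hρ, hρδ, hCρ⟩ : ∃ ρ > 0, 2 * ρ ≤ δ ∧ C * ρ ^ 2 < 4 := by
    refine ⟨min (δ / 2) (1 / √C), lt_min (by positivity) (by positivity), ?_, ?_⟩
    · have := min_le_left (δ / 2) (1 / √C)
      linarith
    · have h2 : min (δ / 2) (1 / √C) ^ 2 ≤ (1 / √C) ^ 2 :=
        pow_le_pow_left₀ (le_min (by positivity) (by positivity)) (min_le_right _ _) 2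
      rw [div_pow, Real.sq_sqrt hCpos.le] at h2
      calc C * min (δ / 2) (1 / √C) ^ 2 ≤ C * (1 ^ 2 / C) := by gcongr
        _ = 1 := by field_simp
        _ < 4 := by norm_num
  set v : ℂ → ℝ := fun w => Real.log (q x₀ ^ 2) - Real.log (q (φ.symm w) ^ 2) with hv
  have hvz := eq_zero_on_ball_of_laplacian_le (v := v) (x₀ := φ x₀) hρ hCρ (fun w hw => by
    obtain ⟨hw1, hw2, hw3⟩ := hball w (Metric.ball_subset_ball hρδ hw)
    obtain ⟨-, hw4, hw5⟩ := quotient_chart_properties hβ hqc hq hφ e hw1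
    obtain ⟨hw6, hw7⟩ := hw5 hw3.ne'
    have hw6' : ContDiffAt ℝ 2 (fun w => Real.log (q (φ.symm w) ^ 2)) w :=
      hw6.of_le (by norm_cast)
    have hvpos : 0 ≤ v w :=
      sub_nonneg.2 (Real.log_le_log (by positivity) (pow_le_pow_left₀ hw3.le (hmax _) 2))
    refine ⟨contDiffAt_const.sub hw6', hvpos, ?_⟩
    have hΔ : (Δ v) w = c w * (1 - q (φ.symm w) ^ 2) := by
      have e1 : v = (fun _ => Real.log (q x₀ ^ 2)) - fun w => Real.log (q (φ.symm w) ^ 2) := rfl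
      rw [e1, ContDiffAt.laplacian_sub contDiffAt_const hw6']
      rw [vortex_rhs_eq hh hφ e hw1 hw4, dzbarDz] at hw7
      simp only [InnerProductSpace.laplacian_const, Pi.zero_apply, hc]
      linear_combination -4 * hw7
    have hq2 : 1 - v w ≤ q (φ.symm w) ^ 2 := by
      have h2 := Real.add_one_le_exp (-v w)
      have h3 : Real.exp (-v w) = q (φ.symm w) ^ 2 / q x₀ ^ 2 := by
        rw [hv, neg_sub, Real.exp_sub, Real.exp_log (by positivity), Real.exp_log (by positivity)]
      have h4 : q (φ.symm w) ^ 2 / q x₀ ^ 2 ≤ q (φ.symm w) ^ 2 :=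
        div_le_self (by positivity) (one_le_pow₀ h1)
      linarith
    calc (Δ v) w = c w * (1 - q (φ.symm w) ^ 2) := hΔ
      _ ≤ c w * v w := mul_le_mul_of_nonneg_left (by linarith) (hc0 w)
      _ ≤ C * v w := mul_le_mul_of_nonneg_right hw2.le hvpos) hCpos.le (by simp [hv, hx₀])
  filter_upwards [φ.open_source.mem_nhds (mem_chart_source ℂ x₀),
    (φ.continuousAt (mem_chart_source ℂ x₀)).eventually (Metric.ball_mem_nhds _ hρ)] with x hx hxρ
  have h2 := hvz _ hxρ
  have h3 := (hball _ (Metric.ball_subset_ball (by linarith) hxρ)).2.2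
  simp only [hv, φ.left_inv hx] at h2 h3
  have h4 := Real.log_injOn_pos (Set.mem_Ioi.2 (by positivity)) (Set.mem_Ioi.2 (by positivity))
    (sub_eq_zero.1 h2)
  exact ((pow_left_inj₀ (by positivity) h3.le two_ne_zero).1 h4).symm

/-- If `q ≥ 1` somewhere, then `q` is constant and the metric `h` is flat, which is impossible on a
bundle of nonzero degree. -/
lemma quotient_lt_one [T2Space X] [CompactSpace X] [ConnectedSpace X] [IsManifold 𝓘(ℂ) ω X]
    {d : ℤ} (hd : HasDegree L d) (hd0 : d ≠ 0) {R : ℝ}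
    {α : SecL2K L} {β : SecLm2K L} (hβ : ∃ x, β.toFun x ≠ 0) {h : HermMetric L}
    (hh : SolvesVortex R α β h) {q : X → ℝ} (hqc : Continuous q)
    (hq : ∀ x, β.toFun x ≠ 0 → q x = quotientNorm α β h x) (x : X) : q x < 1 := by
  by_contra! hx
  obtain ⟨x₀, -, hmax⟩ := isCompact_univ.exists_isMaxOn ⟨x, Set.mem_univ x⟩ hqc.continuousOn
  have hmax' : ∀ y, q y ≤ q x₀ := fun y => hmax (Set.mem_univ y)
  have h1 : 1 ≤ q x₀ := hx.trans (hmax' x)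
  have hopen : IsOpen {y | q y = q x₀} := isOpen_iff_mem_nhds.2 fun y hy => by
    have hy' : q y = q x₀ := hy
    have := eventually_eq_of_one_le_max hβ hh hqc hq (hy' ▸ h1) (fun z => hy' ▸ hmax' z)
    rwa [hy'] at this
  have hconst : ∀ y, q y = q x₀ := fun y => by
    have := IsClopen.eq_univ ⟨isClosed_eq hqc continuous_const, hopen⟩ ⟨x₀, rfl⟩
    exact (this ▸ Set.mem_univ y : y ∈ {y | q y = q x₀})
  refine hd0 (hd.eq_zero_of_flat h fun φ hφ e _ z hz => ?_)
  have h2 := ((quotient_chart_properties hβ hqc hq hφ e hz).2.2 (by rw [hconst]; linarith)).2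
  simp only [hconst, dzbarDz, InnerProductSpace.laplacian_const, Pi.zero_apply] at h2
  rw [dzbarDz]
  linarith

end Maximum

end HiggsSurface

end

theorem mainTheorem4 {X : Type*} [TopologicalSpace X] [T2Space X] [CompactSpace X]
    [ConnectedSpace X] [ChartedSpace ℂ X] [IsManifold 𝓘(ℂ) ω X]
    (L : X → Type*) [∀ x, AddCommGroup (L x)] [∀ x, Module ℂ (L x)]
    [∀ x, TopologicalSpace (L x)] [TopologicalSpace (TotalSpace ℂ L)] [FiberBundle ℂ L]
    [VectorBundle ℂ ℂ L] [ContMDiffVectorBundle ω ℂ L 𝓘(ℂ)]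
    (d : ℤ) (hd : HiggsSurface.HasDegree L d) (hd_pos : 0 < d)
    (α : HiggsSurface.SecL2K L) (β : HiggsSurface.SecLm2K L) (hβ : ∃ x, β.toFun x ≠ 0)
    (hdiv : ∀ x, β.div x ≤ α.div x)
    (ħ : ℂ) (hħ : ħ ≠ 0) (R : ℝ) (hR : 0 ≤ R) (hħR : ‖ħ ^ 2 * (R : ℂ) ^ 2‖ ≤ 1)
    (h : HiggsSurface.HermMetric L) (hh : HiggsSurface.SolvesVortex R α β h) :
    -- `q` is `|α h² / β|` and `m` is `|μ|`, extended continuously over the zeros of `β`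
    ∃ q m : X → ℝ, Continuous q ∧ Continuous m ∧
      (∀ φ ∈ atlas ℂ X, ∀ (e : Trivialization ℂ (π ℂ L)) [MemTrivializationAtlas e],
        ∀ z ∈ HiggsSurface.coordDomain φ e, β.coeff φ e z ≠ 0 →
          q (φ.symm z) = ‖α.coeff φ e z * (h.coeff φ e z : ℂ) ^ 2 / β.coeff φ e z‖ ∧
          m (φ.symm z) = ‖HiggsSurface.muCoeff ħ R α β h φ e z‖) ∧
      -- the sinh-Gordon equation for `u = log q²`, where `u` is finite
      (∀ φ ∈ atlas ℂ X, ∀ (e : Trivialization ℂ (π ℂ L)) [MemTrivializationAtlas e],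
        ∀ z ∈ HiggsSurface.coordDomain φ e, q (φ.symm z) ≠ 0 →
          ContDiffAt ℝ ∞ (fun w => Real.log (q (φ.symm w) ^ 2)) z ∧
          HiggsSurface.dzbarDz (fun w => Real.log (q (φ.symm w) ^ 2)) z =
            8 * R ^ 2 * ‖α.coeff φ e z * β.coeff φ e z‖
              * Real.sinh (Real.log (q (φ.symm z) ^ 2) / 2)) ∧
      -- `u` is negative, also in the sense `u = -∞` at the zeros of `q`
      (∀ x, q x ≠ 0 → Real.log (q x ^ 2) < 0) ∧
      (∀ x, m x < 1) := by
  obtain ⟨q, hqc, hq⟩ := HiggsSurface.exists_continuous_quotient α β hβ hdiv h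
  have hq0 := HiggsSurface.quotient_nonneg hβ hqc hq
  have hq1 := HiggsSurface.quotient_lt_one hd hd_pos.ne' hβ hh hqc hq
  refine ⟨q, fun x => ‖ħ ^ 2 * (R : ℂ) ^ 2‖ * q x, hqc, continuous_const.mul hqc, ?_, ?_, ?_, ?_⟩
  · intro φ hφ e _ z hz hz0
    have h1 : q (φ.symm z) = ‖α.coeff φ e z * (h.coeff φ e z : ℂ) ^ 2 / β.coeff φ e z‖ := by
      rw [hq _ (mt (β.coeff_eq_zero_iff hφ e hz).2 hz0),
        HiggsSurface.quotientNorm_apply_symm α β h hφ e hz, norm_div, norm_mul, norm_pow,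
        Complex.norm_real, Real.norm_of_nonneg (h.coeff_pos e hz).le]
    refine ⟨h1, ?_⟩
    simp only [h1, HiggsSurface.muCoeff, norm_mul, norm_div, RCLike.norm_conj]
    ring
  · intro φ hφ e _ z hz hz0
    obtain ⟨h0, h1, h2⟩ := HiggsSurface.quotient_chart_properties hβ hqc hq hφ e hz
    obtain ⟨h3, h4⟩ := h2 hz0
    refine ⟨h3, ?_⟩
    have h5 := h.coeff_pos e hz
    have hpos : 0 < q (φ.symm z) := lt_of_le_of_ne h0 (Ne.symm hz0)
    have ha : ‖α.coeff φ e z‖ = q (φ.symm z) * ‖β.coeff φ e z‖ / h.coeff φ e z ^ 2 := by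
      rw [← h1]; field_simp
    rw [h4, HiggsSurface.vortex_rhs_eq hh hφ e hz h1, Real.log_pow, norm_mul, ha]
    rw [show ((2 : ℕ) : ℝ) * Real.log (q (φ.symm z)) / 2 = Real.log (q (φ.symm z)) by
      push_cast; ring, Real.sinh_log hpos]
    field_simp
    ring
  · intro x hx
    exact Real.log_neg (by positivity) (pow_lt_one₀ (hq0 x) (hq1 x) two_ne_zero)
  · intro x
    exact (mul_le_of_le_one_left (hq0 x) hħR).trans_lt (hq1 x)
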